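/- Let $k$ be an algebraically closed field of characteristic $0$, let $\mathfrak g,\mathfrak h$ be Lie algebras over $k$ (of arbitrary dimension), and let $\phi:\mathfrak g\to\mathrm{Der}(\mathfrak h)$ be an action of $\mathfrak g$ on $\mathfrak h$ by derivations. Let $T:\mathfrak h\to\mathfrak g$ be a relative Rota–Baxter operator (of weight $1$) with respect to $\phi$, i.e. a linear map with $$[T(u),T(v)]=T\big(\phi(T(u))v-\phi(T(v))u+[u,v]\big)\qquad(u,v\in\mathfrak h).$$ The graph $\mathrm{Gr}_T=\{(u,T(u)) : u\in\mathfrak h\}$ is then a Lie subalgebra of the semidirect product $\mathfrak h\rtimes\mathfrak g$, whose bracket is $[(u,x),(v,y)]=([u,v]+\phi(x)v-\phi(y)u,\,[x,y])$. Give the universal enveloping algebras $U(\mathfrak g),U(\mathfrak h)$ their usual Hopf algebra structures, in which the elements of the Lie algebra are primitive, and let $\bar\phi$ be the $U(\mathfrak g)$-module bialgebra structure on $U(\mathfrak h)$ in which each $x\in\mathfrak g$ acts by the derivation of $U(\mathfrak h)$ extending $\phi(x)$. Write $\rightharpoonup$ for this action and $\Delta(a)=a_1\otimes a_2$ for the comultiplications.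 The smash product Hopf algebra $U(\mathfrak h)\rtimes U(\mathfrak g)$ is the coalgebra $U(\mathfrak h)\otimes U(\mathfrak g)$ with the product $(a\# x)(b\# y)=a(x_1\rightharpoonup b)\# x_2y$. A lift of $T$ is a coalgebra homomorphism $\bar T:U(\mathfrak h)\to U(\mathfrak g)$ with $\bar T|_{\mathfrak h}=T$ and $$\bar T(a)\bar T(b)=\bar T\big(a_1(\bar T(a_2)\rightharpoonup b)\big)\qquad(a,b\in U(\mathfrak h)).$$ Then $T$ has exactly one lift $\bar T$. Its graph $\mathrm{Gr}_{\bar T}=\mathrm{im}\big((\mathrm{id}\otimes\bar T)\Delta\big)=\{a_1\otimes\bar T(a_2) : a\in U(\mathfrak h)\}$ is a Hopf subalgebra of $U(\mathfrak h)\rtimes U(\mathfrak g)$, and there is an isomorphism of Hopf algebras $$U(\mathrm{Gr}_T)\;\cong\;\mathrm{Gr}_{\bar T}.$$ -/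

import Mathlib

open scoped TensorProduct

noncomputable section

namespace UniversalEnvelopingAlgebra

attribute [local instance 100] LieRing.ofAssociativeRing

variable {R : Type*} {L : Type*} [CommRing R] [LieRing L] [LieAlgebra R L]

theorem induction' {P : UniversalEnvelopingAlgebra R L → Prop}
    (algebraMap : ∀ r : R, P (algebraMap R _ r)) (ι : ∀ y : L, P (ι R y))
    (mul : ∀ x y, P x → P y → P (x * y)) (add : ∀ x y, P x → P y → P (x + y))
    (x : UniversalEnvelopingAlgebra R L) : P x := by
  let S : Subalgebra R (UniversalEnvelopingAlgebra R L) :=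
    { carrier := {x | P x}
      mul_mem' := fun {x y} hx hy => mul x y hx hy
      add_mem' := fun {x y} hx hy => add x y hx hy
      algebraMap_mem' := algebraMap }
  let f : L →ₗ⁅R⁆ S :=
    { toFun := fun y => ⟨UniversalEnvelopingAlgebra.ι R y, ι y⟩
      map_add' := fun y z => Subtype.ext (by simp)
      map_smul' := fun r y => Subtype.ext (by simp)
      map_lie' := fun {y z} => Subtype.ext (by
        simp [LieRing.of_associative_ring_bracket]) }
  have h : S.val.comp (lift R f) = AlgHom.id R _ := by
    apply hom_ext
    ext y
    simp only [LieHom.coe_comp, Function.comp_apply, AlgHom.coe_toLieHom, AlgHom.comp_apply, AlgHom.id_apply]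
    rw [lift_ι_apply]
    rfl
  have h2 := DFunLike.congr_fun h x
  rw [AlgHom.comp_apply, AlgHom.id_apply] at h2
  rw [← h2]
  exact (lift R f x).2

variable (R L)

/-- The primitive comultiplication `ι y ↦ ι y ⊗ 1 + 1 ⊗ ι y`. -/
def comulHom : UniversalEnvelopingAlgebra R L →ₐ[R]
    UniversalEnvelopingAlgebra R L ⊗[R] UniversalEnvelopingAlgebra R L :=
  lift R
    { toFun := fun y => ι R y ⊗ₜ[R] 1 + 1 ⊗ₜ[R] ι R y
      map_add' := fun y z => by simp only [map_add, TensorProduct.add_tmul, TensorProduct.tmul_add]; abel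
      map_smul' := fun r y => by
        simp only [map_smul, TensorProduct.smul_tmul', TensorProduct.tmul_smul, smul_add, RingHom.id_apply]
      map_lie' := fun {y z} => by
        simp only [LieHom.map_lie, LieRing.of_associative_ring_bracket, TensorProduct.sub_tmul, TensorProduct.tmul_sub,
          add_mul, mul_add, Algebra.TensorProduct.tmul_mul_tmul, one_mul, mul_one]
        abel }

/-- The augmentation `ι y ↦ 0`. -/
def counitHom : UniversalEnvelopingAlgebra R L →ₐ[R] R := lift R 0

/-- The algebra homomorphism `U(L) → U(L)ᵐᵒᵖ`, `ι y ↦ - ι y`. -/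
def antipodeHom : UniversalEnvelopingAlgebra R L →ₐ[R] (UniversalEnvelopingAlgebra R L)ᵐᵒᵖ :=
  lift R
    { toFun := fun y => MulOpposite.op (- ι R y)
      map_add' := fun y z => by simp only [map_add, neg_add, MulOpposite.op_add]
      map_smul' := fun r y => by simp only [map_smul, RingHom.id_apply, ← smul_neg, MulOpposite.op_smul]
      map_lie' := fun {y z} => by
        simp only [LieHom.map_lie, LieRing.of_associative_ring_bracket, ← MulOpposite.op_mul, ← MulOpposite.op_sub]
        simp }

variable {R L}

@[simp] lemma comulHom_ι (y : L) :
    comulHom R L (ι R y) = ι R y ⊗ₜ[R] 1 + 1 ⊗ₜ[R] ι R y := lift_ι_apply R _ y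

@[simp] lemma counitHom_ι (y : L) : counitHom R L (ι R y) = 0 := lift_ι_apply R _ y

@[simp] lemma antipodeHom_ι (y : L) :
    antipodeHom R L (ι R y) = MulOpposite.op (- ι R y) := lift_ι_apply R _ y

lemma algHom_ext {A : Type*} [Ring A] [Algebra R A] {f g : UniversalEnvelopingAlgebra R L →ₐ[R] A}
    (h : ∀ y : L, f (ι R y) = g (ι R y)) : f = g := by
  apply hom_ext
  ext y
  exact h y

instance instBialgebra : Bialgebra R (UniversalEnvelopingAlgebra R L) :=
  Bialgebra.ofAlgHom (comulHom R L) (counitHom R L)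
    (algHom_ext fun y => by
      simp [-ι_apply, Algebra.TensorProduct.one_def, TensorProduct.add_tmul, TensorProduct.tmul_add]
      abel)
    (algHom_ext fun y => by simp [-ι_apply])
    (algHom_ext fun y => by simp [-ι_apply])

lemma comul_ι (y : L) :
    Coalgebra.comul (R := R) (ι R y) = ι R y ⊗ₜ[R] 1 + 1 ⊗ₜ[R] ι R y := comulHom_ι y

lemma counit_ι (y : L) : Coalgebra.counit (R := R) (ι R y) = 0 := counitHom_ι y

instance instIsCocomm : Coalgebra.IsCocomm R (UniversalEnvelopingAlgebra R L) where
  comm_comp_comul := by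
    have h : (Algebra.TensorProduct.comm R (UniversalEnvelopingAlgebra R L)
          (UniversalEnvelopingAlgebra R L)).toAlgHom.comp (Bialgebra.comulAlgHom R _) =
        Bialgebra.comulAlgHom R (UniversalEnvelopingAlgebra R L) :=
      algHom_ext fun y => by
        simp [-ι_apply, comul_ι]
        abel
    exact congr(($h).toLinearMap)

/-- The antipode of `U(L)`: the anti-homomorphism with `ι y ↦ - ι y`. -/
def antipodeMap : UniversalEnvelopingAlgebra R L →ₗ[R] UniversalEnvelopingAlgebra R L :=
  (MulOpposite.opLinearEquiv R).symm.toLinearMap ∘ₗ (antipodeHom R L).toLinearMap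

lemma antipodeMap_ι (y : L) : antipodeMap (R := R) (ι R y) = - ι R y := by
  simp [-ι_apply, antipodeMap]

lemma antipodeMap_mul (x y : UniversalEnvelopingAlgebra R L) :
    antipodeMap (R := R) (x * y) = antipodeMap (R := R) y * antipodeMap (R := R) x := by
  simp [antipodeMap]

lemma antipodeMap_algebraMap (r : R) :
    antipodeMap (R := R) (algebraMap R (UniversalEnvelopingAlgebra R L) r) = algebraMap R _ r := by
  simp [antipodeMap]

instance instHopfAlgebra : HopfAlgebra R (UniversalEnvelopingAlgebra R L) where
  antipode := antipodeMap
  mul_antipode_rTensor_comul := by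
    refine LinearMap.ext fun x => ?_
    simp only [LinearMap.comp_apply, Algebra.linearMap_apply]
    induction x using induction' with
    | algebraMap r => simp [antipodeMap_algebraMap, Algebra.TensorProduct.algebraMap_apply]
    | ι y =>
      rw [comul_ι, counit_ι]
      have := antipodeMap_algebraMap (L := L) (1 : R)
      simp only [map_one] at this
      simp [-ι_apply, antipodeMap_ι, this]
    | add x y hx hy => simp [hx, hy]
    | mul x y hx hy =>
      have key : ∀ s t : UniversalEnvelopingAlgebra R L ⊗[R] UniversalEnvelopingAlgebra R L,
          ∀ r : R, LinearMap.mul' R _ (antipodeMap.rTensor _ s) = algebraMap R _ r →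
          LinearMap.mul' R _ (antipodeMap.rTensor _ (s * t)) =
            r • LinearMap.mul' R _ (antipodeMap.rTensor _ t) := by
        intro s t r hs
        induction t with
        | zero => simp
        | add t u ht hu => simp only [mul_add, map_add, ht, hu, smul_add]
        | tmul t u =>
          have : ∀ s, LinearMap.mul' R _ (antipodeMap.rTensor _ (s * (t ⊗ₜ[R] u))) =
              antipodeMap t * LinearMap.mul' R _ (antipodeMap.rTensor _ s) * u := by
            intro s
            induction s with
            | zero => simp
            | add s s' h h' => simp only [add_mul, map_add, mul_add, h, h']
            | tmul s s' => simp [antipodeMap_mul, mul_assoc]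
          rw [this, hs, ← Algebra.commutes]
          simp [Algebra.smul_def, mul_assoc]
      rw [Bialgebra.comul_mul, key _ _ _ hx, hy, Bialgebra.counit_mul, map_mul, Algebra.smul_def]
  mul_antipode_lTensor_comul := by
    refine LinearMap.ext fun x => ?_
    simp only [LinearMap.comp_apply, Algebra.linearMap_apply]
    induction x using induction' with
    | algebraMap r =>
      have := antipodeMap_algebraMap (L := L) (1 : R)
      simp only [map_one] at this
      simp [this, Algebra.TensorProduct.algebraMap_apply]
    | ι y =>
      rw [comul_ι, counit_ι]
      have := antipodeMap_algebraMap (L := L) (1 : R)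
      simp only [map_one] at this
      simp [-ι_apply, antipodeMap_ι, this]
    | add x y hx hy => simp [hx, hy]
    | mul x y hx hy =>
      have key : ∀ s t : UniversalEnvelopingAlgebra R L ⊗[R] UniversalEnvelopingAlgebra R L,
          ∀ r : R, LinearMap.mul' R _ (antipodeMap.lTensor _ t) = algebraMap R _ r →
          LinearMap.mul' R _ (antipodeMap.lTensor _ (s * t)) =
            r • LinearMap.mul' R _ (antipodeMap.lTensor _ s) := by
        intro s t r ht
        induction s with
        | zero => simp
        | add t u ht hu => simp only [add_mul, map_add, ht, hu, smul_add]
        | tmul s u =>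
          have : ∀ t, LinearMap.mul' R _ (antipodeMap.lTensor _ ((s ⊗ₜ[R] u) * t)) =
              s * LinearMap.mul' R _ (antipodeMap.lTensor _ t) * antipodeMap u := by
            intro t
            induction t with
            | zero => simp
            | add s s' h h' => simp only [add_mul, map_add, mul_add, h, h']
            | tmul s s' => simp [antipodeMap_mul, mul_assoc]
          rw [this, ht, ← Algebra.commutes]
          simp [Algebra.smul_def, mul_assoc]
      rw [Bialgebra.comul_mul, key _ _ _ hy, hx, Bialgebra.counit_mul, mul_comm, map_mul,
        Algebra.smul_def]

end UniversalEnvelopingAlgebra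

/-- The tensor product `V ⊗ W` of two `H`-modules, `x ⇀ (v ⊗ w) = (x₁ ⇀ v) ⊗ (x₂ ⇀ w)`. -/
def diagAct {R H V W : Type*} [CommRing R] [Ring H] [Bialgebra R H]
    [AddCommGroup V] [Module R V] [AddCommGroup W] [Module R W]
    (ρ : H →ₐ[R] Module.End R V) (σ : H →ₐ[R] Module.End R W) :
    H →ₐ[R] Module.End R (V ⊗[R] W) :=
  (Module.endTensorEndAlgHom (R := R) (S := R) (A := R) (M := V) (N := W)).comp
    ((Algebra.TensorProduct.map ρ σ).comp (Bialgebra.comulAlgHom R H))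

/-- A left `H`-module bialgebra structure on a bialgebra `K`: an action `⇀` of `H` on `K` for
which the multiplication, the unit, the comultiplication and the counit of `K` are `H`-linear. -/
structure ModuleBialgebra (R H K : Type*) [CommRing R] [Ring H] [Bialgebra R H]
    [Ring K] [Bialgebra R K] where
  /-- The action `x ⇀ a = act x a`. -/
  act : H →ₐ[R] Module.End R K
  act_one : ∀ x : H, act x 1 = Coalgebra.counit (R := R) x • (1 : K)
  act_mul : ∀ (x : H) (t : K ⊗[R] K),
    act x (LinearMap.mul' R K t) = LinearMap.mul' R K (diagAct act act x t)
  counit_act : ∀ (x : H) (a : K), Coalgebra.counit (R := R) (act x a) =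
    Coalgebra.counit (R := R) x * Coalgebra.counit (R := R) a
  comul_act : ∀ (x : H) (a : K), Coalgebra.comul (R := R) (act x a) =
    diagAct act act x (Coalgebra.comul a)

section Derivations

open UniversalEnvelopingAlgebra

attribute [local instance 100] LieRing.ofAssociativeRing

variable {R : Type*} {L : Type*} [CommRing R] [LieRing L] [LieAlgebra R L]

/-- The algebra homomorphism `U(L) → U(L)[ε]`, `ι y ↦ ι y + ε ι (D y)`. -/
def dualNumberLift (D : LieDerivation R L L) : UniversalEnvelopingAlgebra R L →ₐ[R]
    TrivSqZeroExt (UniversalEnvelopingAlgebra R L) (UniversalEnvelopingAlgebra R L) :=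
  lift R
    { toFun := fun y => TrivSqZeroExt.inl (ι R y) + TrivSqZeroExt.inr (ι R (D y))
      map_add' := fun y z => by
        simp only [map_add, TrivSqZeroExt.inl_add, TrivSqZeroExt.inr_add]; abel
      map_smul' := fun r y => by
        simp only [map_smul, RingHom.id_apply, smul_add, TrivSqZeroExt.inl_smul,
          TrivSqZeroExt.inr_smul]
      map_lie' := fun {y z} => by
        ext
        · simp [-ι_apply, LieRing.of_associative_ring_bracket]
        · simp [-ι_apply, LieRing.of_associative_ring_bracket]
          abel }

/-- The derivation of `U(L)` that extends the derivation `D` of `L`: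
`y₁ ⋯ yᵣ ↦ ∑ i, y₁ ⋯ D yᵢ ⋯ yᵣ`. -/
def derivExt (D : LieDerivation R L L) :
    UniversalEnvelopingAlgebra R L →ₗ[R] UniversalEnvelopingAlgebra R L where
  toFun x := (dualNumberLift D x).snd
  map_add' x y := by simp
  map_smul' r x := by simp

lemma derivExt_ι (D : LieDerivation R L L) (y : L) : derivExt D (ι R y) = ι R (D y) := by
  change (dualNumberLift D (ι R y)).snd = _
  rw [dualNumberLift, lift_ι_apply]
  simp [-ι_apply]

lemma dualNumberLift_fst (D : LieDerivation R L L) (x : UniversalEnvelopingAlgebra R L) :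
    (dualNumberLift D x).fst = x := by
  have h : (TrivSqZeroExt.fstHom R _ _).comp (dualNumberLift D) = AlgHom.id R _ := by
    refine algHom_ext fun y => ?_
    change (dualNumberLift D (ι R y)).fst = _
    rw [dualNumberLift, lift_ι_apply]
    simp [-ι_apply]
  exact DFunLike.congr_fun h x

lemma derivExt_mul (D : LieDerivation R L L) (x y : UniversalEnvelopingAlgebra R L) :
    derivExt D (x * y) = derivExt D x * y + x * derivExt D y := by
  change (dualNumberLift D (x * y)).snd = (dualNumberLift D x).snd * y + x * (dualNumberLift D y).snd
  simp [dualNumberLift_fst, add_comm]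

lemma derivExt_algebraMap (D : LieDerivation R L L) (r : R) :
    derivExt D (algebraMap R _ r) = 0 := by
  change (dualNumberLift D (algebraMap R _ r)).snd = 0
  simp [TrivSqZeroExt.algebraMap_eq_inl']

lemma derivation_ext {f g : UniversalEnvelopingAlgebra R L →ₗ[R] UniversalEnvelopingAlgebra R L}
    (hf : ∀ x y, f (x * y) = f x * y + x * f y) (hg : ∀ x y, g (x * y) = g x * y + x * g y)
    (h : ∀ y : L, f (ι R y) = g (ι R y)) : f = g := by
  have f1 : f 1 = 0 := by simpa using hf 1 1
  have g1 : g 1 = 0 := by simpa using hg 1 1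
  refine LinearMap.ext fun x => ?_
  induction x using induction' with
  | algebraMap r => simp [Algebra.algebraMap_eq_smul_one, f1, g1]
  | ι y => exact h y
  | add x y hx hy => simp [hx, hy]
  | mul x y hx hy => rw [hf, hg, hx, hy]

variable (R L) in
/-- `derivExt` as a homomorphism of Lie algebras `Der(L) → End(U(L))`. -/
def derivExtHom : LieDerivation R L L →ₗ⁅R⁆ Module.End R (UniversalEnvelopingAlgebra R L) where
  toFun := derivExt
  map_add' D E := derivation_ext (derivExt_mul _)
    (fun x y => by simp only [LinearMap.add_apply, derivExt_mul, add_mul, mul_add]; abel)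
    (fun y => by simp [-ι_apply, derivExt_ι])
  map_smul' r D := derivation_ext (derivExt_mul _)
    (fun x y => by simp [derivExt_mul])
    (fun y => by simp only [derivExt_ι, LieDerivation.coe_smul, Pi.smul_apply, map_smul,
      RingHom.id_apply, LinearMap.smul_apply])
  map_lie' {D E} := derivation_ext (derivExt_mul _)
    (fun x y => by
      simp only [LieRing.of_associative_ring_bracket, LinearMap.sub_apply, Module.End.mul_apply,
        derivExt_mul, map_add, sub_mul, mul_sub]
      abel)
    (fun y => by
      simp only [LieRing.of_associative_ring_bracket, LinearMap.sub_apply, Module.End.mul_apply,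
        derivExt_ι, LieDerivation.lie_apply, map_sub])

variable {g h : Type*} [LieRing g] [LieAlgebra R g] [LieRing h] [LieAlgebra R h]

/-- The action `φ̄` of `U(g)` on `U(h)` that extends the action `φ` of `g` on `h` by derivations. -/
def envelopingAct (φ : g →ₗ⁅R⁆ LieDerivation R h h) :
    UniversalEnvelopingAlgebra R g →ₐ[R] Module.End R (UniversalEnvelopingAlgebra R h) :=
  lift R ((derivExtHom R h).comp φ)

lemma envelopingAct_ι (φ : g →ₗ⁅R⁆ LieDerivation R h h) (x : g) :
    envelopingAct φ (ι R x) = derivExt (φ x) := lift_ι_apply R _ x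

lemma diagAct_ι {V W : Type*} [AddCommGroup V] [Module R V] [AddCommGroup W] [Module R W]
    (ρ : UniversalEnvelopingAlgebra R g →ₐ[R] Module.End R V)
    (σ : UniversalEnvelopingAlgebra R g →ₐ[R] Module.End R W) (x : g) (v : V) (w : W) :
    diagAct ρ σ (ι R x) (v ⊗ₜ w) = ρ (ι R x) v ⊗ₜ w + v ⊗ₜ σ (ι R x) w := by
  simp [-ι_apply, diagAct, comul_ι, Module.endTensorEndAlgHom_apply]

/-- The `U(g)`-module bialgebra `(U(h), φ̄)`. -/
def envelopingModuleBialgebra (φ : g →ₗ⁅R⁆ LieDerivation R h h) :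
    ModuleBialgebra R (UniversalEnvelopingAlgebra R g) (UniversalEnvelopingAlgebra R h) where
  act := envelopingAct φ
  act_one x := by
    induction x using induction' with
    | algebraMap r => simp [Algebra.algebraMap_eq_smul_one]
    | ι y =>
      rw [envelopingAct_ι, counit_ι, ← map_one (algebraMap R _), derivExt_algebraMap, zero_smul]
    | add x y hx hy => simp [hx, hy, add_smul]
    | mul x y hx hy => simp [hx, hy, mul_comm, smul_smul]
  act_mul x := by
    induction x using induction' with
    | algebraMap r => simp [Algebra.algebraMap_eq_smul_one]
    | ι y =>
      intro t
      induction t with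
      | zero => simp
      | add t u ht hu => simp only [map_add, ht, hu]
      | tmul a b => simp only [diagAct_ι, envelopingAct_ι, map_add, LinearMap.mul'_apply, derivExt_mul]
    | add x y hx hy => simp [hx, hy]
    | mul x y hx hy => simp [hx, hy]
  counit_act x := by
    induction x using induction' with
    | algebraMap r => simp [Algebra.algebraMap_eq_smul_one]
    | ι y =>
      intro a
      rw [envelopingAct_ι, counit_ι, zero_mul]
      induction a using induction' with
      | algebraMap r => simp [derivExt_algebraMap]
      | ι z => rw [derivExt_ι, counit_ι]
      | add a b ha hb => simp [ha, hb]
      | mul a b ha hb => simp [derivExt_mul, ha, hb]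
    | add x y hx hy => simp [hx, hy, add_mul]
    | mul x y hx hy => simp [hx, hy, mul_assoc]
  comul_act x := by
    induction x using induction' with
    | algebraMap r => simp [Algebra.algebraMap_eq_smul_one]
    | ι y =>
      have key : ∀ s t, diagAct (envelopingAct φ) (envelopingAct φ) (ι R y) (s * t) =
          diagAct (envelopingAct φ) (envelopingAct φ) (ι R y) s * t +
          s * diagAct (envelopingAct φ) (envelopingAct φ) (ι R y) t := by
        intro s t
        induction s with
        | zero => simp
        | add s s' h h' => simp only [add_mul, map_add, h, h']; abel
        | tmul a b =>
          induction t with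
          | zero => simp
          | add s s' h h' => simp only [mul_add, map_add, h, h']; abel
          | tmul c d =>
            simp only [Algebra.TensorProduct.tmul_mul_tmul, diagAct_ι, envelopingAct_ι,
              derivExt_mul, TensorProduct.add_tmul, TensorProduct.tmul_add, add_mul, mul_add]
            abel
      have d1 : derivExt (φ y) 1 = 0 := by
        rw [← map_one (algebraMap R _), derivExt_algebraMap]
      intro a
      induction a using induction' with
      | algebraMap r =>
        simp only [Algebra.algebraMap_eq_smul_one, map_smul, Bialgebra.comul_one,
          Algebra.TensorProduct.one_def, diagAct_ι, envelopingAct_ι, d1]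
        simp
      | ι z =>
        simp only [envelopingAct_ι, derivExt_ι, comul_ι, map_add, diagAct_ι, d1]
        simp [-ι_apply]
      | add a b ha hb => simp only [map_add, ha, hb]
      | mul a b ha hb =>
        rw [Bialgebra.comul_mul, key, ← ha, ← hb, envelopingAct_ι, derivExt_mul, map_add,
          Bialgebra.comul_mul, Bialgebra.comul_mul]
    | add x y hx hy => simp [hx, hy]
    | mul x y hx hy => simp [hx, hy]

end Derivations

section Smash

variable {R H K : Type*} [CommRing R] [Ring H] [Bialgebra R H] [Ring K] [Bialgebra R K]

/-- The underlying module `K ⊗ H` of the smash product `K ⋊ H`. -/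
def SmashProduct (_M : ModuleBialgebra R H K) : Type _ := K ⊗[R] H

namespace SmashProduct

variable (M : ModuleBialgebra R H K)

instance instAddCommGroup : AddCommGroup (SmashProduct M) := inferInstanceAs (AddCommGroup (K ⊗[R] H))
instance instModule : Module R (SmashProduct M) := inferInstanceAs (Module R (K ⊗[R] H))

/-- The identification of `K ⊗ H` with `K ⋊ H`, `a ⊗ x ↦ a # x`. -/
def of : K ⊗[R] H ≃ₗ[R] SmashProduct M := LinearEquiv.refl R _

/-- Left multiplication by `a # 1`: `b ⊗ y ↦ a b ⊗ y`. -/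
def leftHom : K →ₐ[R] Module.End R (K ⊗[R] H) :=
  (Module.endTensorEndAlgHom (R := R) (S := R) (A := R) (M := K) (N := H)).comp
    (Algebra.TensorProduct.includeLeft.comp (Algebra.lmul R K))

/-- Left multiplication by `1 # x`: `b ⊗ y ↦ (x₁ ⇀ b) ⊗ x₂ y`. -/
def rightHom : H →ₐ[R] Module.End R (K ⊗[R] H) := diagAct M.act (Algebra.lmul R H)

/-- The smash product `(a # x)(b # y) = a (x₁ ⇀ b) # x₂ y`, curried. -/
def mulMap : K ⊗[R] H →ₗ[R] Module.End R (K ⊗[R] H) :=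
  TensorProduct.lift
    ((LinearMap.mul R (Module.End R (K ⊗[R] H))).compl₁₂ leftHom.toLinearMap
      (rightHom M).toLinearMap)

lemma mulMap_tmul (a : K) (x : H) :
    mulMap M (a ⊗ₜ x) = leftHom a * rightHom M x := by simp [mulMap]

lemma leftHom_tmul (a b : K) (y : H) : leftHom (R := R) a (b ⊗ₜ[R] y) = (a * b) ⊗ₜ y := by
  simp [leftHom, Module.endTensorEndAlgHom_apply]

lemma diagAct_tmul {V W : Type*} [AddCommGroup V] [Module R V] [AddCommGroup W] [Module R W]
    (ρ : H →ₐ[R] Module.End R V) (σ : H →ₐ[R] Module.End R W) (x : H) (v : V) (w : W) :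
    diagAct ρ σ x (v ⊗ₜ w) =
      TensorProduct.map (ρ.toLinearMap.flip v) (σ.toLinearMap.flip w) (Coalgebra.comul (R := R) x) := by
  simp only [diagAct, AlgHom.comp_apply, Bialgebra.comulAlgHom_apply]
  induction Coalgebra.comul (R := R) x with
  | zero => simp
  | add s t hs ht => simp only [map_add, LinearMap.add_apply, hs, ht]
  | tmul s t => simp [Module.endTensorEndAlgHom_apply]

lemma rightHom_tmul (x : H) (b : K) (y : H) : rightHom M x (b ⊗ₜ y) =
    TensorProduct.map (M.act.toLinearMap.flip b) (LinearMap.mulRight R y)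
      (Coalgebra.comul (R := R) x) := by
  rw [rightHom, diagAct_tmul]
  rfl

/-- The smash product formula `(a # x)(b # y) = a (x₁ ⇀ b) # x₂ y` in Sweedler notation. -/
lemma mulMap_tmul_tmul {ι : Type*} (a b : K) (x y : H) (r : Coalgebra.Repr R x ι) :
    mulMap M (a ⊗ₜ x) (b ⊗ₜ y) =
      ∑ i ∈ r.index, (a * M.act (r.left i) b) ⊗ₜ (r.right i * y) := by
  rw [mulMap_tmul, Module.End.mul_apply, rightHom_tmul, ← r.eq]
  simp [leftHom_tmul]

lemma mulMap_rightHom (x : H) (q : K ⊗[R] H) :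
    mulMap M (rightHom M x q) = rightHom M x * mulMap M q := by
  induction q with
  | zero => simp
  | add s t hs ht => simp only [map_add, hs, ht, mul_add]
  | tmul b y =>
    rw [mulMap_tmul, ← mul_assoc]
    have h1 : mulMap M (rightHom M x (b ⊗ₜ y)) =
        mulMap M (rightHom M x (b ⊗ₜ 1)) * rightHom M y := by
      rw [rightHom_tmul, rightHom_tmul]
      induction Coalgebra.comul (R := R) x with
      | zero => simp
      | add s t hs ht => simp only [map_add, hs, ht, add_mul]
      | tmul s t => simp [mulMap_tmul, mul_assoc]
    rw [h1]
    congr 1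
    refine TensorProduct.ext' fun c z => ?_
    rw [Module.End.mul_apply, leftHom_tmul, rightHom_tmul, rightHom_tmul]
    let F : H ⊗[R] (H ⊗[R] H) →ₗ[R] K ⊗[R] H :=
      (LinearMap.mul' R K).rTensor H ∘ₗ (TensorProduct.assoc R K K H).symm.toLinearMap ∘ₗ
        TensorProduct.map (M.act.toLinearMap.flip b)
          (TensorProduct.map (M.act.toLinearMap.flip c) (LinearMap.mulRight R z))
    have hF := congrArg F (Coalgebra.coassoc_apply (R := R) x)
    have hL : mulMap M (TensorProduct.map (M.act.toLinearMap.flip b) (LinearMap.mulRight R 1)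
        (Coalgebra.comul (R := R) x)) (c ⊗ₜ z) =
        F ((Coalgebra.comul (R := R)).lTensor H (Coalgebra.comul (R := R) x)) := by
      induction Coalgebra.comul (R := R) x with
      | zero => simp
      | add s t hs ht => simp only [map_add, hs, ht, LinearMap.add_apply]
      | tmul s t =>
        simp only [TensorProduct.map_tmul, LinearMap.mulRight_apply, mul_one, mulMap_tmul,
          Module.End.mul_apply, rightHom_tmul, LinearMap.lTensor_tmul]
        induction Coalgebra.comul (R := R) t with
        | zero => simp
        | add s t hs ht => simp only [map_add, hs, ht, TensorProduct.tmul_add]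
        | tmul u v => simp [leftHom_tmul, F]
    have hR : TensorProduct.map (M.act.toLinearMap.flip (b * c)) (LinearMap.mulRight R z)
        (Coalgebra.comul (R := R) x) =
        F (TensorProduct.assoc R H H H
          ((Coalgebra.comul (R := R)).rTensor H (Coalgebra.comul (R := R) x))) := by
      induction Coalgebra.comul (R := R) x with
      | zero => simp
      | add s t hs ht => simp only [map_add, hs, ht]
      | tmul s t =>
        simp only [TensorProduct.map_tmul, LinearMap.rTensor_tmul]
        have : M.act.toLinearMap.flip (b * c) s = LinearMap.mul' R K (TensorProduct.map
            (M.act.toLinearMap.flip b) (M.act.toLinearMap.flip c) (Coalgebra.comul (R := R) s)) := by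
          have := M.act_mul s (b ⊗ₜ c)
          rw [diagAct_tmul] at this
          simpa using this
        rw [this]
        induction Coalgebra.comul (R := R) s with
        | zero => simp
        | add s t hs ht => simp only [map_add, hs, ht, TensorProduct.add_tmul]
        | tmul u v => simp [F]
    rw [hL, ← hF, hR]

lemma mulMap_leftHom (a : K) (q : K ⊗[R] H) :
    mulMap M (leftHom a q) = leftHom a * mulMap M q := by
  induction q with
  | zero => simp
  | add s t hs ht => simp only [map_add, hs, ht, mul_add]
  | tmul b y => rw [leftHom_tmul, mulMap_tmul, mulMap_tmul, map_mul, mul_assoc]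

lemma mulMap_mulMap (p q : K ⊗[R] H) : mulMap M (mulMap M p q) = mulMap M p * mulMap M q := by
  induction p with
  | zero => simp
  | add s t hs ht => simp only [map_add, LinearMap.add_apply, hs, ht, add_mul]
  | tmul a x =>
    rw [mulMap_tmul, Module.End.mul_apply, mulMap_leftHom, mulMap_rightHom, mul_assoc]

lemma mulMap_one (p : K ⊗[R] H) : mulMap M p (1 ⊗ₜ 1) = p := by
  induction p with
  | zero => simp
  | add s t hs ht => simp only [map_add, LinearMap.add_apply, hs, ht]
  | tmul a x =>
    rw [mulMap_tmul, Module.End.mul_apply, rightHom_tmul]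
    have h := congrArg (fun t => TensorProduct.map (LinearMap.toSpanSingleton R K 1) LinearMap.id t)
      (Coalgebra.rTensor_counit_comul (R := R) x)
    have h2 : TensorProduct.map (M.act.toLinearMap.flip 1) (LinearMap.mulRight R 1)
        (Coalgebra.comul (R := R) x) = (1 : K) ⊗ₜ[R] x := by
      have e : M.act.toLinearMap.flip 1 =
          LinearMap.toSpanSingleton R K 1 ∘ₗ Coalgebra.counit (R := R) :=
        LinearMap.ext fun x => by simp [M.act_one]
      have e2 : LinearMap.mulRight R (1 : H) = LinearMap.id := LinearMap.ext fun x => by simp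
      rw [e, e2]
      simpa [LinearMap.rTensor, TensorProduct.map_map] using h
    rw [h2, leftHom_tmul, mul_one]

instance instRing : Ring (SmashProduct M) where
  __ := instAddCommGroup M
  mul p q := of M (mulMap M ((of M).symm p) ((of M).symm q))
  one := of M (1 ⊗ₜ 1)
  mul_assoc p q r := congrArg (of M) (by
    change mulMap M (mulMap M ((of M).symm p) ((of M).symm q)) ((of M).symm r) = _
    rw [mulMap_mulMap]
    rfl)
  one_mul p := by
    change mulMap M (1 ⊗ₜ 1) ((of M).symm p) = p
    rw [mulMap_tmul, map_one, map_one, one_mul]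
    rfl
  mul_one p := mulMap_one M ((of M).symm p)
  left_distrib p q r := (mulMap M ((of M).symm p)).map_add _ _
  right_distrib _ _ _ := LinearMap.congr_fun ((mulMap M).map_add _ _) _
  zero_mul _ := LinearMap.congr_fun (mulMap M).map_zero _
  mul_zero p := (mulMap M ((of M).symm p)).map_zero

instance instAlgebra : Algebra R (SmashProduct M) := Algebra.ofModule
  (fun r _ _ => LinearMap.congr_fun ((mulMap M).map_smul r _) _)
  (fun r p _ => (mulMap M ((of M).symm p)).map_smul r _)

instance instCoalgebra : Coalgebra R (SmashProduct M) := inferInstanceAs (Coalgebra R (K ⊗[R] H))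

lemma of_mul_of (p q : K ⊗[R] H) : of M p * of M q = of M (mulMap M p q) := rfl

lemma one_def : (1 : SmashProduct M) = of M (1 ⊗ₜ 1) := rfl

/-- The comultiplication is that of the tensor product of the coalgebras `K` and `H`. -/
lemma comul_of (p : K ⊗[R] H) : Coalgebra.comul (R := R) (of M p) =
    TensorProduct.map (of M).toLinearMap (of M).toLinearMap (Coalgebra.comul (R := R) p) := by
  have : (of M).toLinearMap = LinearMap.id := rfl
  rw [this]
  exact (LinearMap.congr_fun TensorProduct.map_id _).symm

lemma counit_of (p : K ⊗[R] H) :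
    Coalgebra.counit (R := R) (of M p) = Coalgebra.counit (R := R) p := rfl

lemma leftHom_one_tmul (a : K) (x : H) : leftHom (R := R) a (1 ⊗ₜ[R] x) = a ⊗ₜ x := by
  rw [leftHom_tmul, mul_one]

/-- The embedding `a ↦ a # 1`. -/
def inl : K →ₐ[R] SmashProduct M := AlgHom.ofLinearMap
  ((of M).toLinearMap ∘ₗ (TensorProduct.mk R K H).flip 1) rfl (fun a b => by
    change of M ((a * b) ⊗ₜ 1) = of M (mulMap M (a ⊗ₜ 1) (b ⊗ₜ 1))
    rw [mulMap_tmul, map_one, mul_one, leftHom_tmul])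

/-- The embedding `x ↦ 1 # x`. -/
def inr : H →ₐ[R] SmashProduct M := AlgHom.ofLinearMap
  ((of M).toLinearMap ∘ₗ TensorProduct.mk R K H 1) rfl (fun x y => by
    change of M (1 ⊗ₜ (x * y)) = of M (mulMap M (1 ⊗ₜ x) (1 ⊗ₜ y))
    rw [mulMap_tmul, map_one, one_mul]
    have h1 : ∀ x : H, rightHom M x (1 ⊗ₜ 1) = 1 ⊗ₜ x := fun x => by
      have := mulMap_one M (1 ⊗ₜ x)
      rwa [mulMap_tmul, map_one, one_mul] at this
    rw [← h1 y, ← Module.End.mul_apply, ← map_mul, h1])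

lemma inl_mul_inr (a : K) (x : H) : inl M a * inr M x = of M (a ⊗ₜ x) := by
  change of M (mulMap M (a ⊗ₜ 1) (1 ⊗ₜ x)) = _
  rw [mulMap_tmul, map_one, mul_one, leftHom_one_tmul]

lemma inr_mul_inl (x : H) (b : K) : inr M x * inl M b =
    LinearMap.mul' R _ (TensorProduct.map ((inl M).toLinearMap ∘ₗ M.act.toLinearMap.flip b)
      (inr M).toLinearMap (Coalgebra.comul (R := R) x)) := by
  change of M (mulMap M (1 ⊗ₜ x) (b ⊗ₜ 1)) = _
  rw [mulMap_tmul, map_one, one_mul, rightHom_tmul]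
  induction Coalgebra.comul (R := R) x with
  | zero => simp
  | add s t hs ht => simp only [map_add, hs, ht]
  | tmul u v => simp [inl_mul_inr]

lemma comul_inl_mul_inr (a : K) (x : H) : Coalgebra.comul (R := R) (inl M a * inr M x) =
    Algebra.TensorProduct.map (inl M) (inl M) (Coalgebra.comul (R := R) a) *
      Algebra.TensorProduct.map (inr M) (inr M) (Coalgebra.comul (R := R) x) := by
  rw [inl_mul_inr, comul_of, TensorProduct.comul_tmul]
  induction Coalgebra.comul (R := R) a with
  | zero => simp
  | add s t hs ht => simp only [map_add, hs, ht, add_mul, TensorProduct.add_tmul]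
  | tmul a a' =>
    induction Coalgebra.comul (R := R) x with
    | zero => simp
    | add s t hs ht => simp only [map_add, hs, ht, mul_add, TensorProduct.tmul_add]
    | tmul x x' => simp [inl_mul_inr]

lemma induction_mul {P : SmashProduct M → Prop} (zero : P 0) (add : ∀ p q, P p → P q → P (p + q))
    (mul : ∀ a x, P (inl M a * inr M x)) (p : SmashProduct M) : P p := by
  have : ∀ q, P (of M q) := fun q => by
    induction q with
    | zero => exact zero
    | add s t hs ht => exact add _ _ hs ht
    | tmul a x => rw [← inl_mul_inr]; exact mul a x
  exact this ((of M).symm p)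

lemma comul_inl_mul_mul_inr (a : K) (y : H) (p : SmashProduct M) :
    Coalgebra.comul (R := R) (inl M a * p * inr M y) =
    Algebra.TensorProduct.map (inl M) (inl M) (Coalgebra.comul (R := R) a) *
      Coalgebra.comul (R := R) p *
      Algebra.TensorProduct.map (inr M) (inr M) (Coalgebra.comul (R := R) y) := by
  induction p using induction_mul with
  | zero => simp
  | add p q hp hq => simp only [mul_add, add_mul, map_add, hp, hq]
  | mul b x =>
    rw [← mul_assoc, ← map_mul, mul_assoc, ← map_mul, comul_inl_mul_inr, comul_inl_mul_inr,
      Bialgebra.comul_mul, Bialgebra.comul_mul, map_mul, map_mul]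
    simp only [mul_assoc]

lemma comul_inr_mul_inl [Coalgebra.IsCocomm R H] (x : H) (b : K) :
    Coalgebra.comul (R := R) (inr M x * inl M b) =
      Algebra.TensorProduct.map (inr M) (inr M) (Coalgebra.comul (R := R) x) *
      Algebra.TensorProduct.map (inl M) (inl M) (Coalgebra.comul (R := R) b) := by
  have h1 : Coalgebra.comul (R := R) (inr M x * inl M b) = LinearMap.mul' R _ (TensorProduct.map
      ((Algebra.TensorProduct.map (inl M) (inl M)).toLinearMap ∘ₗ
        (diagAct M.act M.act).toLinearMap.flip (Coalgebra.comul (R := R) b))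
      ((Algebra.TensorProduct.map (inr M) (inr M)).toLinearMap ∘ₗ Coalgebra.comul (R := R))
      (Coalgebra.comul (R := R) x)) := by
    rw [inr_mul_inl]
    induction Coalgebra.comul (R := R) x with
    | zero => simp
    | add s t hs ht => simp only [map_add, hs, ht]
    | tmul u v =>
      simp [comul_inl_mul_inr, M.comul_act]
      rfl
  rw [h1]
  clear h1
  induction Coalgebra.comul (R := R) b with
  | zero => simp
  | add s t hs ht =>
    simp only [map_add, mul_add, LinearMap.comp_add, TensorProduct.map_add_left,
      LinearMap.add_apply, hs, ht]
  | tmul b b' =>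
    let G : (H ⊗[R] H) ⊗[R] (H ⊗[R] H) →ₗ[R] SmashProduct M ⊗[R] SmashProduct M :=
      TensorProduct.map
        (LinearMap.mul' R _ ∘ₗ TensorProduct.map
          ((inl M).toLinearMap ∘ₗ M.act.toLinearMap.flip b) (inr M).toLinearMap)
        (LinearMap.mul' R _ ∘ₗ TensorProduct.map
          ((inl M).toLinearMap ∘ₗ M.act.toLinearMap.flip b') (inr M).toLinearMap)
    have hc := congrArg G (LinearMap.congr_fun (Coalgebra.comulCoalgHom R H).map_comp_comul x)
    have hR : Algebra.TensorProduct.map (inr M) (inr M) (Coalgebra.comul (R := R) x) *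
        Algebra.TensorProduct.map (inl M) (inl M) (b ⊗ₜ[R] b') =
        G (TensorProduct.map (Coalgebra.comul (R := R)) (Coalgebra.comul (R := R))
          (Coalgebra.comul (R := R) x)) := by
      induction Coalgebra.comul (R := R) x with
      | zero => simp
      | add s t hs ht => simp only [map_add, hs, ht, add_mul]
      | tmul u v => simp [G, inr_mul_inl]
    rw [hR]
    refine Eq.trans ?_ hc.symm
    have : ∀ t, G (Coalgebra.comul (R := R) t) = LinearMap.mul' R _ (TensorProduct.map
      ((Algebra.TensorProduct.map (inl M) (inl M)).toLinearMap ∘ₗ TensorProduct.map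
        (M.act.toLinearMap.flip b) (M.act.toLinearMap.flip b'))
      (Algebra.TensorProduct.map (inr M) (inr M)).toLinearMap
      (TensorProduct.map (Coalgebra.comul (R := R)) (Coalgebra.comul (R := R)) t)) := by
      intro t
      induction t with
      | zero => simp
      | add s t hs ht => simp only [map_add, hs, ht]
      | tmul u v =>
        rw [TensorProduct.comul_tmul]
        simp only [TensorProduct.map_tmul]
        induction Coalgebra.comul (R := R) u with
        | zero => simp
        | add s t hs ht => simp only [map_add, hs, ht, TensorProduct.add_tmul]
        | tmul a a' =>
          induction Coalgebra.comul (R := R) v with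
          | zero => simp
          | add s t hs ht => simp only [map_add, hs, ht, TensorProduct.tmul_add]
          | tmul x x' => simp [G]
    refine Eq.trans ?_ (this (Coalgebra.comul (R := R) x)).symm
    induction Coalgebra.comul (R := R) x with
    | zero => simp
    | add s t hs ht => simp only [map_add, hs, ht]
    | tmul u v =>
      simp [diagAct_tmul]

lemma comul_mul [Coalgebra.IsCocomm R H] (p q : SmashProduct M) :
    Coalgebra.comul (R := R) (p * q) = Coalgebra.comul (R := R) p * Coalgebra.comul (R := R) q := by
  induction p using induction_mul with
  | zero => simp
  | add p q hp hq => simp only [add_mul, map_add, hp, hq]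
  | mul a x =>
    induction q using induction_mul with
    | zero => simp
    | add p q hp hq => simp only [mul_add, map_add, hp, hq]
    | mul b y =>
      have : inl M a * inr M x * (inl M b * inr M y) = inl M a * (inr M x * inl M b) * inr M y := by
        simp only [mul_assoc]
      rw [this, comul_inl_mul_mul_inr, comul_inr_mul_inl, comul_inl_mul_inr, comul_inl_mul_inr]
      simp only [mul_assoc]

lemma counit_inl_mul_inr (a : K) (x : H) : Coalgebra.counit (R := R) (inl M a * inr M x) =
    Coalgebra.counit (R := R) a * Coalgebra.counit (R := R) x := by
  rw [inl_mul_inr, counit_of, TensorProduct.counit_tmul, smul_eq_mul, mul_comm]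

lemma counit_inr_mul_inl (x : H) (b : K) : Coalgebra.counit (R := R) (inr M x * inl M b) =
    Coalgebra.counit (R := R) x * Coalgebra.counit (R := R) b := by
  have h : Coalgebra.counit (R := R) (inr M x * inl M b) = Coalgebra.counit (R := R) b *
      Coalgebra.counit (R := R) (TensorProduct.lid R H
        ((Coalgebra.counit (R := R)).rTensor H (Coalgebra.comul (R := R) x))) := by
    rw [inr_mul_inl]
    induction Coalgebra.comul (R := R) x with
    | zero => simp
    | add s t hs ht => simp only [map_add, hs, ht, mul_add]
    | tmul u v => simp [counit_inl_mul_inr, M.counit_act]; ring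
  rw [h, Coalgebra.rTensor_counit_comul]
  simp [mul_comm]

lemma counit_mul (p q : SmashProduct M) : Coalgebra.counit (R := R) (p * q) =
    Coalgebra.counit (R := R) p * Coalgebra.counit (R := R) q := by
  induction p using induction_mul with
  | zero => simp
  | add p q hp hq => simp only [add_mul, map_add, hp, hq]
  | mul a x =>
    induction q using induction_mul with
    | zero => simp
    | add p q hp hq => simp only [mul_add, map_add, hp, hq]
    | mul b y =>
      have : inl M a * inr M x * (inl M b * inr M y) = inl M a * (inr M x * inl M b) * inr M y := by
        simp only [mul_assoc]
      have h2 : ∀ p : SmashProduct M, Coalgebra.counit (R := R) (inl M a * p * inr M y) =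
          Coalgebra.counit (R := R) a * Coalgebra.counit (R := R) p *
            Coalgebra.counit (R := R) y := by
        intro p
        induction p using induction_mul with
        | zero => simp
        | add p q hp hq => simp only [mul_add, add_mul, map_add, hp, hq]
        | mul c z =>
          rw [← mul_assoc, ← map_mul, mul_assoc, ← map_mul, counit_inl_mul_inr, counit_inl_mul_inr,
            Bialgebra.counit_mul, Bialgebra.counit_mul]
          ring
      rw [this, h2, counit_inr_mul_inl, counit_inl_mul_inr, counit_inl_mul_inr]
      ring

/-- The bialgebra structure of `K ⋊ H` for cocommutative `H`. -/
instance instBialgebra [Coalgebra.IsCocomm R H] : Bialgebra R (SmashProduct M) :=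
  Bialgebra.mk' R (SmashProduct M)
    (by
      have := counit_inl_mul_inr M 1 1
      rw [map_one, map_one, one_mul] at this
      simpa using this)
    (counit_mul M _ _)
    (by
      have := comul_inl_mul_inr M 1 1
      rw [map_one, map_one, one_mul] at this
      simpa using this)
    (comul_mul M _ _)

end SmashProduct
end Smash

namespace SmashProduct

variable {R H K : Type*} [CommRing R] [Ring H] [HopfAlgebra R H] [Ring K] [HopfAlgebra R K]
  (M : ModuleBialgebra R H K)

/-- The antipode `S(a # x) = (1 # S x)(S a # 1) = (S(x)₁ ⇀ S a) # S(x)₂`. -/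
def antipodeMap : SmashProduct M →ₗ[R] SmashProduct M :=
  TensorProduct.lift ((LinearMap.mul R (SmashProduct M)).flip.compl₁₂
    ((inl M).toLinearMap ∘ₗ HopfAlgebra.antipode R)
    ((inr M).toLinearMap ∘ₗ HopfAlgebra.antipode R)) ∘ₗ (of M).symm.toLinearMap

lemma antipodeMap_inl_mul_inr (a : K) (x : H) : antipodeMap M (inl M a * inr M x) =
    inr M (HopfAlgebra.antipode R x) * inl M (HopfAlgebra.antipode R a) := by
  rw [inl_mul_inr]
  simp [antipodeMap]

instance instHopfAlgebra [Coalgebra.IsCocomm R H] : HopfAlgebra R (SmashProduct M) where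
  antipode := antipodeMap M
  mul_antipode_rTensor_comul := by
    refine LinearMap.ext fun p => ?_
    simp only [LinearMap.comp_apply, Algebra.linearMap_apply]
    induction p using induction_mul with
    | zero => simp
    | add p q hp hq => simp only [map_add, hp, hq]
    | mul a x =>
      rw [comul_inl_mul_inr, counit_inl_mul_inr]
      have h : ∀ s t, LinearMap.mul' R _ ((antipodeMap M).rTensor _
          (Algebra.TensorProduct.map (inl M) (inl M) s *
            Algebra.TensorProduct.map (inr M) (inr M) t)) =
          LinearMap.mul' R _ (TensorProduct.map
            (LinearMap.mulRight R (inl M (LinearMap.mul' R _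
              ((HopfAlgebra.antipode R).rTensor K s))) ∘ₗ (inr M).toLinearMap ∘ₗ
                HopfAlgebra.antipode R)
            (inr M).toLinearMap t) := by
        intro s t
        induction t with
        | zero => simp
        | add t t' ht ht' => simp only [map_add, mul_add, ht, ht']
        | tmul x y =>
          induction s with
          | zero => simp
          | add s s' h h' =>
            simp only [TensorProduct.map_tmul, LinearMap.mul'_apply, LinearMap.comp_apply,
              LinearMap.mulRight_apply] at h h' ⊢
            simp only [map_add, mul_add, add_mul, h, h']
          | tmul a b => simp [antipodeMap_inl_mul_inr, mul_assoc]
      rw [h, HopfAlgebra.mul_antipode_rTensor_comul_apply]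
      have h2 := congrArg (inr M) (HopfAlgebra.mul_antipode_rTensor_comul_apply (R := R) x)
      rw [AlgHom.commutes] at h2
      rw [AlgHom.commutes, map_mul, ← h2]
      induction Coalgebra.comul (R := R) x with
      | zero => simp
      | add s t hs ht => simp only [map_add, hs, ht, mul_add]
      | tmul u v => simp [Algebra.algebraMap_eq_smul_one]
  mul_antipode_lTensor_comul := by
    refine LinearMap.ext fun p => ?_
    simp only [LinearMap.comp_apply, Algebra.linearMap_apply]
    induction p using induction_mul with
    | zero => simp
    | add p q hp hq => simp only [map_add, hp, hq]
    | mul a x =>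
      rw [comul_inl_mul_inr, counit_inl_mul_inr]
      have h : ∀ s t, LinearMap.mul' R _ ((antipodeMap M).lTensor _
          (Algebra.TensorProduct.map (inl M) (inl M) s *
            Algebra.TensorProduct.map (inr M) (inr M) t)) =
          LinearMap.mul' R _ (TensorProduct.map
            (LinearMap.mulRight R (inr M (LinearMap.mul' R _
              ((HopfAlgebra.antipode R).lTensor H t))) ∘ₗ (inl M).toLinearMap)
            ((inl M).toLinearMap ∘ₗ HopfAlgebra.antipode R) s) := by
        intro s t
        induction s with
        | zero => simp
        | add t t' ht ht' => simp only [map_add, add_mul, ht, ht']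
        | tmul a b =>
          induction t with
          | zero => simp
          | add s s' h h' =>
            simp only [TensorProduct.map_tmul, LinearMap.mul'_apply, LinearMap.comp_apply,
              LinearMap.mulRight_apply] at h h' ⊢
            simp only [map_add, mul_add, add_mul, h, h']
          | tmul x y => simp [antipodeMap_inl_mul_inr, mul_assoc]
      rw [h, HopfAlgebra.mul_antipode_lTensor_comul_apply]
      have h2 := congrArg (inl M) (HopfAlgebra.mul_antipode_lTensor_comul_apply (R := R) a)
      rw [AlgHom.commutes] at h2
      rw [AlgHom.commutes, map_mul, ← h2]
      induction Coalgebra.comul (R := R) a with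
      | zero => simp
      | add s t hs ht => simp only [map_add, hs, ht, add_mul]
      | tmul u v => simp [Algebra.algebraMap_eq_smul_one]

end SmashProduct
section HopfSub

/-- A Hopf subalgebra: a subalgebra `B` with `Δ(B) ⊆ B ⊗ B` and `S(B) ⊆ B`. -/
structure HopfSubalgebra (k A : Type*) [Field k] [Ring A] [HopfAlgebra k A]
    extends Subalgebra k A where
  comul_mem' : ∀ a ∈ carrier, Coalgebra.comul (R := k) a ∈
    LinearMap.range (TensorProduct.map toSubalgebra.val.toLinearMap toSubalgebra.val.toLinearMap)
  antipode_mem' : ∀ a ∈ carrier, HopfAlgebra.antipode k a ∈ carrier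

namespace HopfSubalgebra

lemma map_map_assoc_rTensor {k A V : Type*} [Field k] [Ring A] [HopfAlgebra k A]
    [AddCommGroup V] [Module k V] (i : V →ₗ[k] A) (δ : V →ₗ[k] V ⊗[k] V)
    (h : ∀ v, TensorProduct.map i i (δ v) = Coalgebra.comul (R := k) (i v)) (t : V ⊗[k] V) :
    TensorProduct.map i (TensorProduct.map i i) (TensorProduct.assoc k V V V (δ.rTensor V t)) =
      TensorProduct.assoc k A A A ((Coalgebra.comul (R := k)).rTensor A
        (TensorProduct.map i i t)) := by
  induction t with
  | zero => simp
  | add s t hs ht => simp only [map_add, hs, ht]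
  | tmul a b =>
    simp only [LinearMap.rTensor_tmul, TensorProduct.map_tmul]
    rw [← h]
    induction δ a with
    | zero => simp
    | add s t hs ht => simp only [map_add, hs, ht, TensorProduct.add_tmul]
    | tmul u v => simp

lemma map_map_lTensor {k A V : Type*} [Field k] [Ring A] [HopfAlgebra k A]
    [AddCommGroup V] [Module k V] (i : V →ₗ[k] A) (δ : V →ₗ[k] V ⊗[k] V)
    (h : ∀ v, TensorProduct.map i i (δ v) = Coalgebra.comul (R := k) (i v)) (t : V ⊗[k] V) :
    TensorProduct.map i (TensorProduct.map i i) (δ.lTensor V t) =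
      (Coalgebra.comul (R := k)).lTensor A (TensorProduct.map i i t) := by
  induction t with
  | zero => simp
  | add s t hs ht => simp only [map_add, hs, ht]
  | tmul a b => simp [h]

variable {k A : Type*} [Field k] [Ring A] [HopfAlgebra k A] (B : HopfSubalgebra k A)

/-- The inclusion `B → A`. -/
abbrev incl : B.toSubalgebra →ₗ[k] A := B.toSubalgebra.val.toLinearMap

lemma incl_injective : Function.Injective B.incl := Subtype.val_injective

lemma map_incl_injective : Function.Injective (TensorProduct.map B.incl B.incl) :=
  TensorProduct.map_injective_of_flat_flat _ _ B.incl_injective B.incl_injective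

lemma map_map_incl_injective :
    Function.Injective (TensorProduct.map B.incl (TensorProduct.map B.incl B.incl)) :=
  TensorProduct.map_injective_of_flat_flat _ _ B.incl_injective B.map_incl_injective

/-- The comultiplication of `A` restricted to `B → B ⊗ B`. -/
def comulMap : B.toSubalgebra →ₗ[k] B.toSubalgebra ⊗[k] B.toSubalgebra :=
  (LinearEquiv.ofInjective _ B.map_incl_injective).symm.toLinearMap ∘ₗ
    LinearMap.codRestrict _ (Coalgebra.comul (R := k) ∘ₗ B.incl)
      (fun a => B.comul_mem' a a.2)

/-- The antipode of `A` restricted to `B → B`. -/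
def antipodeMap : B.toSubalgebra →ₗ[k] B.toSubalgebra :=
  LinearMap.codRestrict (Subalgebra.toSubmodule B.toSubalgebra)
    (HopfAlgebra.antipode k ∘ₗ B.incl) (fun a => B.antipode_mem' a a.2)

lemma map_incl_comulMap (a : B.toSubalgebra) :
    TensorProduct.map B.incl B.incl (B.comulMap a) = Coalgebra.comul (R := k) (a : A) :=
  congrArg Subtype.val (LinearEquiv.apply_symm_apply
    (LinearEquiv.ofInjective _ B.map_incl_injective) _)

instance instCoalgebra : Coalgebra k B.toSubalgebra where
  comul := B.comulMap
  counit := Coalgebra.counit (R := k) ∘ₗ B.incl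
  coassoc := by
    refine LinearMap.ext fun a => B.map_map_incl_injective ?_
    simp only [LinearMap.comp_apply, LinearEquiv.coe_coe]
    rw [map_map_assoc_rTensor B.incl B.comulMap B.map_incl_comulMap,
      map_map_lTensor B.incl B.comulMap B.map_incl_comulMap, map_incl_comulMap,
      Coalgebra.coassoc_apply]
  rTensor_counit_comp_comul := by
    refine LinearMap.ext fun a => ?_
    have hinj : Function.Injective (B.incl.lTensor k) :=
      Module.Flat.lTensor_preserves_injective_linearMap _ B.incl_injective
    apply hinj
    have h : ∀ t, B.incl.lTensor k ((Coalgebra.counit (R := k) ∘ₗ B.incl).rTensor _ t) =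
        (Coalgebra.counit (R := k)).rTensor A (TensorProduct.map B.incl B.incl t) := by
      intro t
      induction t with
      | zero => simp
      | add s t hs ht => simp only [map_add, hs, ht]
      | tmul a b => simp
    rw [LinearMap.comp_apply, h, map_incl_comulMap, Coalgebra.rTensor_counit_comul]
    simp
  lTensor_counit_comp_comul := by
    refine LinearMap.ext fun a => ?_
    have hinj : Function.Injective (B.incl.rTensor k) :=
      Module.Flat.rTensor_preserves_injective_linearMap _ B.incl_injective
    apply hinj
    have h : ∀ t, B.incl.rTensor k ((Coalgebra.counit (R := k) ∘ₗ B.incl).lTensor _ t) =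
        (Coalgebra.counit (R := k)).lTensor A (TensorProduct.map B.incl B.incl t) := by
      intro t
      induction t with
      | zero => simp
      | add s t hs ht => simp only [map_add, hs, ht]
      | tmul a b => simp
    rw [LinearMap.comp_apply, h, map_incl_comulMap, Coalgebra.lTensor_counit_comul]
    simp

instance instBialgebra : Bialgebra k B.toSubalgebra :=
  Bialgebra.mk' k B.toSubalgebra
    (Bialgebra.counit_one (R := k) (A := A))
    (fun {a b} => Bialgebra.counit_mul (R := k) (a : A) (b : A))
    (B.map_incl_injective (by
      rw [show Coalgebra.comul (R := k) (1 : B.toSubalgebra) = B.comulMap 1 from rfl,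
        map_incl_comulMap]
      simp [Algebra.TensorProduct.one_def]))
    (fun {a b} => B.map_incl_injective (by
      have hm : ∀ s t, TensorProduct.map B.incl B.incl (s * t) =
          TensorProduct.map B.incl B.incl s * TensorProduct.map B.incl B.incl t :=
        fun s t => map_mul (Algebra.TensorProduct.map B.toSubalgebra.val B.toSubalgebra.val) s t
      have hc : ∀ a : B.toSubalgebra, TensorProduct.map B.incl B.incl
          (Coalgebra.comul (R := k) a) = Coalgebra.comul (R := k) (a : A) := B.map_incl_comulMap
      rw [hm, hc, hc, hc]
      exact Bialgebra.comul_mul _ _))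

instance instHopfAlgebra : HopfAlgebra k B.toSubalgebra where
  antipode := B.antipodeMap
  mul_antipode_rTensor_comul := by
    refine LinearMap.ext fun a => B.incl_injective ?_
    have h : ∀ t, B.incl (LinearMap.mul' k _ (B.antipodeMap.rTensor _ t)) =
        LinearMap.mul' k A ((HopfAlgebra.antipode k).rTensor A
          (TensorProduct.map B.incl B.incl t)) := by
      intro t
      induction t with
      | zero => simp
      | add s t hs ht => simp only [map_add, hs, ht]
      | tmul a b =>
      simp [antipodeMap]
      rfl
    simp only [LinearMap.comp_apply]
    rw [h]
    refine (congrArg _ (congrArg _ (B.map_incl_comulMap a))).trans ?_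
    rw [HopfAlgebra.mul_antipode_rTensor_comul_apply]
    rfl
  mul_antipode_lTensor_comul := by
    refine LinearMap.ext fun a => B.incl_injective ?_
    have h : ∀ t, B.incl (LinearMap.mul' k _ (B.antipodeMap.lTensor _ t)) =
        LinearMap.mul' k A ((HopfAlgebra.antipode k).lTensor A
          (TensorProduct.map B.incl B.incl t)) := by
      intro t
      induction t with
      | zero => simp
      | add s t hs ht => simp only [map_add, hs, ht]
      | tmul a b =>
      simp [antipodeMap]
      rfl
    simp only [LinearMap.comp_apply]
    rw [h]
    refine (congrArg _ (congrArg _ (B.map_incl_comulMap a))).trans ?_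
    rw [HopfAlgebra.mul_antipode_lTensor_comul_apply]
    rfl

end HopfSubalgebra
end HopfSub

section RotaBaxter

variable {R : Type*} [CommRing R]

/-- A relative Rota-Baxter operator (of weight `1`) `T : 𝔥 → 𝔤` on a Lie algebra `𝔤` with respect to
an action `φ` of `𝔤` on the Lie algebra `𝔥` by derivations. -/
def IsRelativeRotaBaxterLie {𝔤 𝔥 : Type*} [LieRing 𝔤] [LieAlgebra R 𝔤] [LieRing 𝔥] [LieAlgebra R 𝔥]
    (φ : 𝔤 →ₗ⁅R⁆ LieDerivation R 𝔥 𝔥) (T : 𝔥 →ₗ[R] 𝔤) : Prop :=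
  ∀ u v : 𝔥, ⁅T u, T v⁆ = T (φ (T u) v - φ (T v) u + ⁅u, v⁆)

/-- The graph `{(u, T u) | u ∈ 𝔥}` of a relative Rota-Baxter operator, as a Lie subalgebra of the
semidirect product `𝔥 ⋊ 𝔤`. -/
def lieGraph {𝔤 𝔥 : Type*} [LieRing 𝔤] [LieAlgebra R 𝔤] [LieRing 𝔥] [LieAlgebra R 𝔥]
    (φ : 𝔤 →ₗ⁅R⁆ LieDerivation R 𝔥 𝔥) (T : 𝔥 →ₗ[R] 𝔤) (hT : IsRelativeRotaBaxterLie φ T) :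
    LieSubalgebra R (LieAlgebra.SemiDirectSum 𝔥 𝔤 φ) where
  carrier := Set.range fun u : 𝔥 => (⟨u, T u⟩ : LieAlgebra.SemiDirectSum 𝔥 𝔤 φ)
  add_mem' := by
    rintro _ _ ⟨u, rfl⟩ ⟨v, rfl⟩
    exact ⟨u + v, by simp⟩
  zero_mem' := ⟨0, by simp⟩
  smul_mem' := by
    rintro r _ ⟨u, rfl⟩
    exact ⟨r • u, by simp⟩
  lie_mem' := by
    rintro _ _ ⟨u, rfl⟩ ⟨v, rfl⟩
    refine ⟨⁅u, v⁆ + φ (T u) v - φ (T v) u, ?_⟩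
    simp only [LieAlgebra.SemiDirectSum.lie_eq_mk]
    rw [hT u v]
    congr 2
    abel

variable {H K : Type*} [Ring H] [Bialgebra R H] [Ring K] [Bialgebra R K]

/-- The bilinear product `a *_T b = a₁ (T(a₂) ⇀ b)` on `K`, for a linear map `T : K → H`. -/
def rotaBaxterProduct (M : ModuleBialgebra R H K) (T : K →ₗ[R] H) (a b : K) : K :=
  LinearMap.mul' R K
    (TensorProduct.map LinearMap.id (M.act.toLinearMap.flip b ∘ₗ T) (Coalgebra.comul (R := R) a))

/-- A relative Rota-Baxter operator `T : K → H` with respect to an `H`-module bialgebra `(K, ⇀)`: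
a coalgebra homomorphism with `T(a) T(b) = T(a₁ (T(a₂) ⇀ b))`. -/
def IsRelativeRotaBaxterHopf (M : ModuleBialgebra R H K) (T : K →ₗc[R] H) : Prop :=
  ∀ a b : K, T a * T b = T (rotaBaxterProduct M T.toLinearMap a b)

/-- The graph `{a₁ ⊗ f(a₂) | a ∈ K}` of a coalgebra homomorphism `f : K → H`, i.e. the image of
`(id ⊗ f) ∘ Δ`, as a subspace of `K ⊗ H`. -/
def coalgGraph (f : K →ₗc[R] H) : Submodule R (K ⊗[R] H) :=
  LinearMap.range (TensorProduct.map LinearMap.id f.toLinearMap ∘ₗ Coalgebra.comul (R := R))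

/-- `Tbar : U(𝔥) → U(𝔤)` is the lift of `T : 𝔥 → 𝔤`: a relative Rota-Baxter operator with respect to
the `U(𝔤)`-module bialgebra `(U(𝔥), φ̄)` that restricts to `T` on `𝔥`. -/
structure IsRotaBaxterLift {𝔤 𝔥 : Type*} [LieRing 𝔤] [LieAlgebra R 𝔤] [LieRing 𝔥] [LieAlgebra R 𝔥]
    (φ : 𝔤 →ₗ⁅R⁆ LieDerivation R 𝔥 𝔥) (T : 𝔥 →ₗ[R] 𝔤)
    (Tbar : UniversalEnvelopingAlgebra R 𝔥 →ₗc[R] UniversalEnvelopingAlgebra R 𝔤) : Prop where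
  rotaBaxter : IsRelativeRotaBaxterHopf (envelopingModuleBialgebra φ) Tbar
  restrict : ∀ u : 𝔥,
    Tbar (UniversalEnvelopingAlgebra.ι R u) = UniversalEnvelopingAlgebra.ι R (T u)

end RotaBaxter

end

/-!
The graph `Gr_T` is a Lie subalgebra of `𝔥 ⋊ 𝔤` complementary to `𝔤`, so its enveloping algebra maps
to the smash product `U(𝔥) ⋊ U(𝔤)` by a homomorphism of bialgebras `Ψ = toSmash`. Let `p` and `q` be
the coalgebra projections of the smash product to `U(𝔥)` and `U(𝔤)`. Everything follows once
`p ∘ Ψ : U(Gr_T) → U(𝔥)` is known to be bijective (`toBase_bijective`):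

* A coalgebra homomorphism to the smash product is recovered from its two projections
  (`SmashProduct.map_proj_comul`). Hence `Tbar = q ∘ Ψ ∘ (p ∘ Ψ)⁻¹` has the image of `Ψ` as its graph.
  This image is closed under multiplication, and comparing both projections of a product of two of
  its elements gives the Rota-Baxter identity (`isRotaBaxterLift_rotaBaxterLift`).
* Conversely, the Rota-Baxter identity for `a = u ∈ 𝔥` forces every lift `Tbar` to satisfy
  `Tbar ∘ p ∘ Ψ = q ∘ Ψ`, by induction along left multiplication by `Gr_T` (`lift_toBase`). This gives
  uniqueness, and identifies the graph with the image of `Ψ`.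
* `Ψ` is injective since `p ∘ Ψ` is, so `U(Gr_T)` is isomorphic to its image.

Bijectivity does not need the Poincaré-Birkhoff-Witt theorem. The decomposition `𝔥 ⋊ 𝔤 = Gr_T ⊕ 𝔤`
makes `U(Gr_T)` the module of `𝔥 ⋊ 𝔤` induced from the trivial module of `𝔤`: `Gr_T` acts by left
multiplication, and `𝔤` by the Leibniz rule of the matched pair `(Gr_T, 𝔤)` (`matchedAct`). Its
restriction to `𝔥` makes `U(Gr_T)` a `U(𝔥)`-module (`baseHom`). The map `p ∘ Ψ` is a homomorphism of
modules, from which it is surjective, and `a ↦ a · 1` is a left inverse of it (`baseHom_toBase`).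
-/

/-! ### Generators of enveloping algebras -/

namespace UniversalEnvelopingAlgebra

/-- Induction along left multiplication by the generators. -/
theorem induction_mul_left {R L : Type*} [CommRing R] [LieRing L] [LieAlgebra R L]
    {P : UniversalEnvelopingAlgebra R L → Prop} (one : P 1)
    (add : ∀ x y, P x → P y → P (x + y)) (smul : ∀ (r : R) x, P x → P (r • x))
    (mul : ∀ (y : L) x, P x → P (ι R y * x)) (x : UniversalEnvelopingAlgebra R L) : P x := by
  suffices h : ∀ c, P c → P (x * c) by simpa using h 1 one
  induction x using induction' with
  | algebraMap r => exact fun c hc => by rw [← Algebra.smul_def]; exact smul r c hc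
  | ι y => exact mul y
  | add x y hx hy => exact fun c hc => by rw [add_mul]; exact add _ _ (hx c hc) (hy c hc)
  | mul x y hx hy => exact fun c hc => by rw [mul_assoc]; exact hx _ (hy c hc)

end UniversalEnvelopingAlgebra

namespace RotaBaxterGraph

open UniversalEnvelopingAlgebra

attribute [local instance 100] LieRing.ofAssociativeRing

variable {R : Type*} [CommRing R] {𝔤 𝔥 : Type*} [LieRing 𝔤] [LieAlgebra R 𝔤] [LieRing 𝔥]
  [LieAlgebra R 𝔥] {φ : 𝔤 →ₗ⁅R⁆ LieDerivation R 𝔥 𝔥} {T : 𝔥 →ₗ[R] 𝔤}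

/-! ### The graph and its enveloping algebra -/

/-- The linear bijection `u ↦ (u, T u)` from `𝔥` to the graph of `T`. -/
noncomputable def graphMap (hT : IsRelativeRotaBaxterLie φ T) : 𝔥 →ₗ[R] lieGraph φ T hT where
  toFun u := ⟨⟨u, T u⟩, u, rfl⟩
  map_add' u v := Subtype.ext (by simp)
  map_smul' r u := Subtype.ext (by simp)

lemma graphMap_surjective (hT : IsRelativeRotaBaxterLie φ T) :
    Function.Surjective (graphMap hT) := by
  rintro ⟨_, u, rfl⟩
  exact ⟨u, rfl⟩

lemma lie_graphMap (hT : IsRelativeRotaBaxterLie φ T) (u v : 𝔥) :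
    ⁅graphMap hT u, graphMap hT v⁆ = graphMap hT (⁅u, v⁆ + φ (T u) v - φ (T v) u) := by
  refine Subtype.ext ?_
  change ⁅(⟨u, T u⟩ : LieAlgebra.SemiDirectSum 𝔥 𝔤 φ), (⟨v, T v⟩ : LieAlgebra.SemiDirectSum 𝔥 𝔤 φ)⁆ =
    (⟨_, T _⟩ : LieAlgebra.SemiDirectSum 𝔥 𝔤 φ)
  rw [LieAlgebra.SemiDirectSum.lie_eq_mk]
  simp only [hT u v]
  congr 2
  abel

/-- The generator `(u, T u)` of the enveloping algebra of the graph of `T`. -/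
noncomputable def gen (hT : IsRelativeRotaBaxterLie φ T) :
    𝔥 →ₗ[R] UniversalEnvelopingAlgebra R (lieGraph φ T hT) :=
  (ι R : lieGraph φ T hT →ₗ⁅R⁆ _).toLinearMap ∘ₗ graphMap hT

variable {hT : IsRelativeRotaBaxterLie φ T}

lemma gen_apply (u : 𝔥) : gen hT u = ι R (graphMap hT u) := rfl

lemma gen_lie (u v : 𝔥) : gen hT (⁅u, v⁆ + φ (T u) v - φ (T v) u) =
    gen hT u * gen hT v - gen hT v * gen hT u := by
  rw [gen_apply, ← lie_graphMap, LieHom.map_lie, LieRing.of_associative_ring_bracket]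
  rfl

theorem induction_gen {P : UniversalEnvelopingAlgebra R (lieGraph φ T hT) → Prop} (one : P 1)
    (add : ∀ x y, P x → P y → P (x + y)) (smul : ∀ (r : R) x, P x → P (r • x))
    (mul : ∀ (u : 𝔥) x, P x → P (gen hT u * x))
    (x : UniversalEnvelopingAlgebra R (lieGraph φ T hT)) : P x :=
  induction_mul_left one add smul (fun y x hx => by
    obtain ⟨u, rfl⟩ := graphMap_surjective hT y
    exact mul u x hx) x

/-- The universal property of `U(Gr_T)` in terms of the parametrization of `Gr_T` by `𝔥`. -/
noncomputable def graphLift {A : Type*} [Ring A] [Algebra R A] (f : 𝔥 →ₗ[R] A)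
    (hf : ∀ u v, f (⁅u, v⁆ + φ (T u) v - φ (T v) u) = f u * f v - f v * f u) :
    UniversalEnvelopingAlgebra R (lieGraph φ T hT) →ₐ[R] A :=
  lift R
    { toLinearMap := f ∘ₗ LieAlgebra.SemiDirectSum.projl φ ∘ₗ
        (lieGraph φ T hT).toSubmodule.subtype
      map_lie' := fun {y z} => by
        obtain ⟨u, rfl⟩ := graphMap_surjective hT y
        obtain ⟨v, rfl⟩ := graphMap_surjective hT z
        rw [lie_graphMap]
        exact hf u v }

lemma graphLift_gen {A : Type*} [Ring A] [Algebra R A] (f : 𝔥 →ₗ[R] A)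
    (hf : ∀ u v, f (⁅u, v⁆ + φ (T u) v - φ (T v) u) = f u * f v - f v * f u) (u : 𝔥) :
    graphLift (hT := hT) f hf (gen hT u) = f u :=
  lift_ι_apply R _ (graphMap hT u)

/-! ### The matched pair of the graph and the acting Lie algebra -/

variable (φ T) in
/-- The component in `𝔤` of the bracket `[x, (u, T u)]` for the decomposition
`𝔥 ⋊ 𝔤 = Gr_T ⊕ 𝔤`. Its component in `Gr_T` is `(φ(x)u, T(φ(x)u))`. -/
noncomputable def reflect (u : 𝔥) : 𝔤 →ₗ[R] 𝔤 where
  toFun x := ⁅x, T u⁆ - T (φ x u)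
  map_add' x y := by simp only [add_lie, map_add, LieDerivation.add_apply]; abel
  map_smul' r x := by
    simp only [smul_lie, map_smul, LieDerivation.smul_apply, RingHom.id_apply, smul_sub]

lemma reflect_apply (u : 𝔥) (x : 𝔤) : reflect φ T u x = ⁅x, T u⁆ - T (φ x u) := rfl

lemma map_lie_apply (x y : 𝔤) (u : 𝔥) : φ ⁅x, y⁆ u = φ x (φ y u) - φ y (φ x u) := by
  rw [LieHom.map_lie, LieDerivation.lie_apply]

/-- Compatibility of the two actions of the matched pair `(Gr_T, 𝔤)`, component in `Gr_T`. -/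
lemma act_graph_bracket (x : 𝔤) (u v : 𝔥) :
    φ x (⁅u, v⁆ + φ (T u) v - φ (T v) u) =
      (⁅φ x u, v⁆ + φ (T (φ x u)) v - φ (T v) (φ x u)) +
      (⁅u, φ x v⁆ + φ (T u) (φ x v) - φ (T (φ x v)) u) +
      φ (reflect φ T u x) v - φ (reflect φ T v x) u := by
  simp only [reflect_apply, map_add, map_sub, LieDerivation.sub_apply, map_lie_apply,
    LieDerivation.apply_lie_eq_add]
  abel

/-- Compatibility of the two actions of the matched pair `(Gr_T, 𝔤)`: the graph acts on `𝔤`. -/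
lemma reflect_graph_bracket (hT : IsRelativeRotaBaxterLie φ T) (x : 𝔤) (u v : 𝔥) :
    reflect φ T (⁅u, v⁆ + φ (T u) v - φ (T v) u) x =
      reflect φ T v (reflect φ T u x) - reflect φ T u (reflect φ T v x) := by
  have h1 : T (⁅u, v⁆ + φ (T u) v - φ (T v) u) = ⁅T u, T v⁆ := by
    rw [hT]; congr 1; abel
  have h2 := hT (φ x u) v
  have h3 := hT u (φ x v)
  rw [reflect_apply, h1, act_graph_bracket]
  simp only [reflect_apply, map_add, map_sub, LieDerivation.sub_apply, map_lie_apply] at h2 h3 ⊢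
  rw [leibniz_lie x (T u) (T v), ← lie_skew ⁅x, T v⁆ (T u), h2, ← lie_skew (T (φ x v)) (T u), h3]
  abel

variable (hT) in
/-- The endomorphism
`(d, f) ↦ ((u, T u) d, x ↦ (φ(x)u, T(φ(x)u)) d + (u, T u) f(x) + f([x, T u] - T(φ(x)u)))`
of `U(Gr_T) × Hom(𝔤, U(Gr_T))`. Its second component is the Leibniz rule for an action of `𝔤`,
so that the orbit of `(1, 0)` under `U(Gr_T)` consists of the pairs `(c, x ↦ x · c)`. -/
noncomputable def pairAct : 𝔥 →ₗ[R] Module.End R (UniversalEnvelopingAlgebra R (lieGraph φ T hT) ×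
    (𝔤 →ₗ[R] UniversalEnvelopingAlgebra R (lieGraph φ T hT))) :=
  LinearMap.mk₂ R (fun u p => (gen hT u * p.1,
      { toFun := fun x => gen hT (φ x u) * p.1 + gen hT u * p.2 x + p.2 (reflect φ T u x)
        map_add' := fun x y => by
          simp only [map_add, LieDerivation.add_apply, add_mul, mul_add]; abel
        map_smul' := fun r x => by
          simp only [map_smul, LieDerivation.smul_apply, smul_mul_assoc, mul_smul_comm,
            RingHom.id_apply, smul_add] }))
    (fun u v p => Prod.ext (by simp only [map_add, add_mul, Prod.fst_add])
      (LinearMap.ext fun x => by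
      simp only [map_add, add_mul, Prod.snd_add, LinearMap.coe_mk, AddHom.coe_mk, reflect_apply,
        LinearMap.add_apply, lie_add, map_sub]
      abel))
    (fun r u p => Prod.ext (by simp only [map_smul, smul_mul_assoc, Prod.smul_fst])
      (LinearMap.ext fun x => by
        simp only [map_smul, smul_mul_assoc, Prod.smul_snd, LinearMap.coe_mk, AddHom.coe_mk,
          reflect_apply, LinearMap.smul_apply, lie_smul, map_sub, smul_add, smul_sub]))
    (fun u p q => Prod.ext (by simp only [mul_add, Prod.fst_add]) (LinearMap.ext fun x => by
      simp only [mul_add, Prod.snd_add, Prod.fst_add, LinearMap.coe_mk, AddHom.coe_mk,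
        LinearMap.add_apply]
      abel))
    (fun r u p => Prod.ext (by simp only [mul_smul_comm, Prod.smul_fst])
      (LinearMap.ext fun x => by
        simp only [mul_smul_comm, Prod.smul_snd, Prod.smul_fst, LinearMap.coe_mk, AddHom.coe_mk,
          LinearMap.smul_apply, smul_add]))

lemma pairAct_fst (u : 𝔥) (p : UniversalEnvelopingAlgebra R (lieGraph φ T hT) ×
    (𝔤 →ₗ[R] UniversalEnvelopingAlgebra R (lieGraph φ T hT))) :
    (pairAct hT u p).1 = gen hT u * p.1 := rfl

lemma pairAct_snd (u : 𝔥) (p : UniversalEnvelopingAlgebra R (lieGraph φ T hT) ×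
    (𝔤 →ₗ[R] UniversalEnvelopingAlgebra R (lieGraph φ T hT))) (x : 𝔤) :
    (pairAct hT u p).2 x = gen hT (φ x u) * p.1 + gen hT u * p.2 x + p.2 (reflect φ T u x) := rfl

lemma pairAct_lie (u v : 𝔥) : pairAct hT (⁅u, v⁆ + φ (T u) v - φ (T v) u) =
    pairAct hT u * pairAct hT v - pairAct hT v * pairAct hT u := by
  refine LinearMap.ext fun p => Prod.ext ?_ (LinearMap.ext fun x => ?_)
  · simp only [LinearMap.sub_apply, Module.End.mul_apply, Prod.fst_sub, pairAct_fst, gen_lie,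
      sub_mul, mul_assoc]
  · rw [pairAct_snd, act_graph_bracket, reflect_graph_bracket hT, map_sub, map_add, map_add,
      gen_lie, gen_lie, gen_lie]
    simp only [LinearMap.sub_apply, Module.End.mul_apply, Prod.snd_sub, pairAct_fst, pairAct_snd,
      map_sub, sub_mul, add_mul, mul_add, mul_assoc]
    abel

variable (hT) in
/-- The action of `𝔤` on `U(Gr_T)` with `x · 1 = 0` that satisfies the Leibniz rule
`x · (u c) = (φ(x)u) c + u (x · c) + ([x, T u] - T(φ(x)u)) · c` of the matched pair `(Gr_T, 𝔤)`,
where elements of `𝔥` stand for the corresponding elements of `Gr_T`. -/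
noncomputable def matchedAct :
    𝔤 →ₗ[R] Module.End R (UniversalEnvelopingAlgebra R (lieGraph φ T hT)) :=
  (LinearMap.snd R _ _ ∘ₗ (LinearMap.applyₗ (1, 0)) ∘ₗ
    (graphLift (hT := hT) (pairAct hT) pairAct_lie).toLinearMap).flip

lemma matchedAct_one (x : 𝔤) : matchedAct hT x 1 = 0 := by
  simp [matchedAct]

lemma graphLift_pairAct_fst (c : UniversalEnvelopingAlgebra R (lieGraph φ T hT)) :
    (graphLift (hT := hT) (pairAct hT) pairAct_lie c (1, 0)).1 = c := by
  induction c using induction_gen with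
  | one => simp
  | add x y hx hy => simp only [map_add, LinearMap.add_apply, Prod.fst_add, hx, hy]
  | smul r x hx => simp only [map_smul, LinearMap.smul_apply, Prod.smul_fst, hx]
  | mul u x hx =>
    rw [map_mul, graphLift_gen, Module.End.mul_apply, pairAct_fst, hx]

lemma matchedAct_gen_mul (x : 𝔤) (u : 𝔥) (c : UniversalEnvelopingAlgebra R (lieGraph φ T hT)) :
    matchedAct hT x (gen hT u * c) = gen hT (φ x u) * c + gen hT u * matchedAct hT x c +
      matchedAct hT (reflect φ T u x) c := by
  change (graphLift (hT := hT) (pairAct hT) pairAct_lie (gen hT u * c) (1, 0)).2 x = _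
  rw [map_mul, graphLift_gen, Module.End.mul_apply, pairAct_snd, graphLift_pairAct_fst]
  rfl

lemma matchedAct_lie (x y : 𝔤) (c : UniversalEnvelopingAlgebra R (lieGraph φ T hT)) :
    matchedAct hT ⁅x, y⁆ c =
      matchedAct hT x (matchedAct hT y c) - matchedAct hT y (matchedAct hT x c) := by
  induction c using induction_gen generalizing x y with
  | one => simp only [matchedAct_one, map_zero, sub_zero]
  | add c d hc hd => simp only [map_add, hc, hd]; abel
  | smul r c hc => simp only [map_smul, hc, smul_sub]
  | mul u c hc =>
    have h : reflect φ T u ⁅x, y⁆ = ⁅reflect φ T u x, y⁆ + ⁅x, reflect φ T u y⁆ +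
        reflect φ T (φ y u) x - reflect φ T (φ x u) y := by
      simp only [reflect_apply, map_lie_apply, map_sub, lie_sub, sub_lie]
      rw [lie_lie x y (T u), ← lie_skew ⁅x, T u⁆ y, ← lie_skew (T (φ x u)) y]
      abel
    simp only [matchedAct_gen_mul, map_add, h, map_sub, LinearMap.add_apply, LinearMap.sub_apply,
      hc, map_lie_apply, sub_mul, mul_sub]
    abel

/-! ### The enveloping algebra of the graph as a module over that of the base -/

variable (hT) in
/-- The action of `u ∈ 𝔥` on `U(Gr_T)`, from the decomposition `u = (u, T u) - T u` in `𝔥 ⋊ 𝔤`. -/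
noncomputable def baseAct : 𝔥 →ₗ[R] Module.End R (UniversalEnvelopingAlgebra R (lieGraph φ T hT)) :=
  LinearMap.mul R _ ∘ₗ gen hT - matchedAct hT ∘ₗ T

lemma baseAct_apply (u : 𝔥) (c : UniversalEnvelopingAlgebra R (lieGraph φ T hT)) :
    baseAct hT u c = gen hT u * c - matchedAct hT (T u) c := rfl

lemma baseAct_lie (u v : 𝔥) :
    baseAct hT ⁅u, v⁆ = baseAct hT u * baseAct hT v - baseAct hT v * baseAct hT u := by
  refine LinearMap.ext fun c => ?_
  have h1 := congrArg (· * c) (gen_lie (hT := hT) u v)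
  have h2 : T ⁅u, v⁆ = ⁅T u, T v⁆ - T (φ (T u) v) + T (φ (T v) u) := by
    rw [hT u v, map_add, map_sub]; abel
  have h3 : reflect φ T u (T v) = - ⁅T u, T v⁆ - T (φ (T v) u) := by
    rw [reflect_apply, lie_skew]
  simp only [map_add, map_sub, add_mul, sub_mul, mul_assoc] at h1
  have h1' : gen hT ⁅u, v⁆ * c = gen hT u * (gen hT v * c) - gen hT v * (gen hT u * c) -
      gen hT (φ (T u) v) * c + gen hT (φ (T v) u) * c := by
    rw [← h1]; abel
  simp only [baseAct_apply, LinearMap.sub_apply, Module.End.mul_apply, map_sub,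
    matchedAct_gen_mul, h1', h2, h3, reflect_apply, map_add, map_neg, LinearMap.add_apply,
    LinearMap.neg_apply, matchedAct_lie]
  abel

variable (hT) in
/-- The `U(𝔥)`-module structure of `U(Gr_T)`. -/
noncomputable def baseHom : UniversalEnvelopingAlgebra R 𝔥 →ₐ[R]
    Module.End R (UniversalEnvelopingAlgebra R (lieGraph φ T hT)) :=
  lift R
    { toLinearMap := baseAct hT
      map_lie' := fun {u v} => baseAct_lie u v }

lemma baseHom_ι (u : 𝔥) : baseHom hT (ι R u) = baseAct hT u := lift_ι_apply R _ u

/-- The actions of `𝔥` and `𝔤` on `U(Gr_T)` combine to one of `𝔥 ⋊ 𝔤`. -/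
lemma matchedAct_baseHom (x : 𝔤) (a : UniversalEnvelopingAlgebra R 𝔥)
    (c : UniversalEnvelopingAlgebra R (lieGraph φ T hT)) :
    matchedAct hT x (baseHom hT a c) =
      baseHom hT (derivExt (φ x) a) c + baseHom hT a (matchedAct hT x c) := by
  induction a using induction' generalizing c with
  | algebraMap r =>
    rw [derivExt_algebraMap, map_zero, LinearMap.zero_apply, zero_add, AlgHom.commutes]
    simp [Module.algebraMap_end_apply]
  | ι u =>
    rw [derivExt_ι, baseHom_ι, baseHom_ι]
    simp only [baseAct_apply, map_sub, matchedAct_gen_mul, reflect_apply, LinearMap.sub_apply,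
      matchedAct_lie]
    abel
  | add a b ha hb => simp only [map_add, LinearMap.add_apply, ha, hb]; abel
  | mul a b ha hb =>
    rw [derivExt_mul, map_mul, map_add, map_mul, map_mul]
    simp only [LinearMap.add_apply, Module.End.mul_apply, ha, hb, map_add]
    abel

lemma matchedAct_baseHom_one (x : 𝔤) (a : UniversalEnvelopingAlgebra R 𝔥) :
    matchedAct hT x (baseHom hT a 1) = baseHom hT (derivExt (φ x) a) 1 := by
  rw [matchedAct_baseHom, matchedAct_one, map_zero, add_zero]

end RotaBaxterGraph

/-! ### The projections of a smash product -/

namespace SmashProduct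

variable {R H K : Type*} [CommRing R] [Ring H] [Bialgebra R H] [Ring K] [Bialgebra R K]
  (M : ModuleBialgebra R H K)

/-- The coalgebra homomorphism `a # x ↦ ε(x) a`. -/
noncomputable def projLeft : SmashProduct M →ₗc[R] K :=
  ((Coalgebra.TensorProduct.rid R R K).toCoalgHom.comp
    (Coalgebra.TensorProduct.map (CoalgHom.id R K) (Coalgebra.counitCoalgHom R H)) :
      K ⊗[R] H →ₗc[R] K)

/-- The coalgebra homomorphism `a # x ↦ ε(a) x`. -/
noncomputable def projRight : SmashProduct M →ₗc[R] H :=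
  ((Coalgebra.TensorProduct.lid R H).toCoalgHom.comp
    (Coalgebra.TensorProduct.map (Coalgebra.counitCoalgHom R K) (CoalgHom.id R H)) :
      K ⊗[R] H →ₗc[R] H)

lemma projLeft_of (a : K) (x : H) :
    projLeft M (of M (a ⊗ₜ x)) = Coalgebra.counit (R := R) x • a := rfl

lemma projRight_of (a : K) (x : H) :
    projRight M (of M (a ⊗ₜ x)) = Coalgebra.counit (R := R) a • x := rfl

lemma projLeft_one : projLeft M 1 = 1 := by
  rw [one_def, projLeft_of, Bialgebra.counit_one, one_smul]

lemma projRight_one : projRight M 1 = 1 := by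
  rw [one_def, projRight_of, Bialgebra.counit_one, one_smul]

/-- The identity `z = p(z₁) # q(z₂)` for the two projections `p` and `q` of a smash product: a
coalgebra homomorphism to the smash product is determined by its composites with them. -/
lemma map_proj_comul (z : SmashProduct M) :
    of M (TensorProduct.map (projLeft M).toLinearMap (projRight M).toLinearMap
      (Coalgebra.comul (R := R) z)) = z := by
  induction z using induction_mul with
  | zero => simp
  | add p q hp hq => simp only [map_add, hp, hq]
  | mul a x =>
    rw [inl_mul_inr, comul_of, TensorProduct.comul_tmul]
    congr 1
    have h : ∀ (s : K ⊗[R] K) (t : H ⊗[R] H),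
        TensorProduct.map (projLeft M).toLinearMap (projRight M).toLinearMap
          (TensorProduct.map (of M).toLinearMap (of M).toLinearMap
            (TensorProduct.AlgebraTensorModule.tensorTensorTensorComm R R R R K K H H
              (s ⊗ₜ[R] t))) =
        TensorProduct.rid R K ((Coalgebra.counit (R := R)).lTensor K s) ⊗ₜ[R]
          TensorProduct.lid R H ((Coalgebra.counit (R := R)).rTensor H t) := by
      intro s t
      induction s with
      | zero => simp
      | add s s' h h' => simp only [map_add, TensorProduct.add_tmul, h, h']
      | tmul a b =>
        induction t with
        | zero => simp
        | add s s' h h' => simp only [map_add, TensorProduct.tmul_add, h, h']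
        | tmul x y =>
          simp [projLeft_of, projRight_of, TensorProduct.smul_tmul']
          rw [smul_comm]
    rw [h]
    simp

lemma projLeft_mul (a : K) (x : H) (z : SmashProduct M) :
    projLeft M (of M (a ⊗ₜ x) * z) = a * M.act x (projLeft M z) := by
  induction z using induction_mul with
  | zero => simp
  | add p q hp hq => simp only [mul_add, map_add, hp, hq]
  | mul b y =>
    rw [inl_mul_inr, of_mul_of, mulMap_tmul, Module.End.mul_apply, rightHom_tmul, projLeft_of]
    have h : ∀ t : H ⊗[R] H, projLeft M (of M (leftHom a (TensorProduct.map
        (M.act.toLinearMap.flip b) (LinearMap.mulRight R y) t))) =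
        Coalgebra.counit (R := R) y • (a * M.act (TensorProduct.rid R H
          ((Coalgebra.counit (R := R)).lTensor H t)) b) := by
      intro t
      induction t with
      | zero => simp
      | add s s' h h' => simp only [map_add, LinearMap.add_apply, mul_add, smul_add, h, h']
      | tmul u v =>
        simp only [TensorProduct.map_tmul, leftHom_tmul, projLeft_of]
        simp [smul_smul, mul_comm]
    rw [h]
    simp

lemma projRight_mul (z w : SmashProduct M) :
    projRight M (z * w) = projRight M z * projRight M w := by
  induction z using induction_mul with
  | zero => simp
  | add p q hp hq => simp only [add_mul, map_add, hp, hq]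
  | mul a x =>
  induction w using induction_mul with
  | zero => simp
  | add p q hp hq => simp only [mul_add, map_add, hp, hq]
  | mul b y =>
    rw [inl_mul_inr, inl_mul_inr, of_mul_of, mulMap_tmul, Module.End.mul_apply, rightHom_tmul,
      projRight_of, projRight_of]
    have h : ∀ t : H ⊗[R] H, projRight M (of M (leftHom a (TensorProduct.map
        (M.act.toLinearMap.flip b) (LinearMap.mulRight R y) t))) =
        (Coalgebra.counit (R := R) a * Coalgebra.counit (R := R) b) • (TensorProduct.lid R H
          ((Coalgebra.counit (R := R)).rTensor H t) * y) := by
      intro t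
      induction t with
      | zero => simp
      | add s s' h h' => simp only [map_add, add_mul, smul_add, h, h']
      | tmul u v =>
        simp only [TensorProduct.map_tmul, leftHom_tmul, projRight_of]
        simp [smul_smul, M.counit_act, mul_comm, mul_left_comm]
    rw [h]
    simp [smul_smul, mul_comm]

end SmashProduct

/-! ### Homomorphisms of bialgebras between Hopf algebras -/

/-- A homomorphism of bialgebras between Hopf algebras commutes with the antipodes: its composites
with them are a left and a right inverse of it for the convolution product. -/
lemma BialgHom.map_antipode {R A B : Type*} [CommRing R] [Ring A] [HopfAlgebra R A] [Ring B]
    [HopfAlgebra R B] (f : A →ₐc[R] B) (a : A) :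
    f (HopfAlgebra.antipode R a) = HopfAlgebra.antipode R (f a) := by
  have h1 : WithConv.toConv ((f : A →ₐ[R] B).toLinearMap ∘ₗ HopfAlgebra.antipode R) *
      WithConv.toConv (f : A →ₐ[R] B).toLinearMap = 1 := by
    have h := LinearMap.algHom_comp_convMul_distrib (f : A →ₐ[R] B)
      (WithConv.toConv (HopfAlgebra.antipode R (A := A))) (WithConv.toConv LinearMap.id)
    rw [LinearMap.antipode_mul_id] at h
    refine (congrArg WithConv.toConv h).symm.trans (WithConv.ext (LinearMap.ext fun x => ?_))
    exact (f : A →ₐ[R] B).commutes _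
  have h2 : WithConv.toConv (f : A →ₐ[R] B).toLinearMap *
      WithConv.toConv (HopfAlgebra.antipode R ∘ₗ (f : A →ₐ[R] B).toLinearMap) = 1 := by
    have h := LinearMap.convMul_comp_coalgHom_distrib
      (WithConv.toConv LinearMap.id) (WithConv.toConv (HopfAlgebra.antipode R (A := B)))
      (f : A →ₗc[R] B)
    rw [LinearMap.id_mul_antipode] at h
    refine (congrArg WithConv.toConv h).symm.trans (WithConv.ext (LinearMap.ext fun x => ?_))
    exact congrArg (algebraMap R B) (CoalgHomClass.counit_comp_apply f x)
  exact LinearMap.congr_fun (congrArg WithConv.ofConv (left_inv_eq_right_inv h1 h2)) a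

/-- The image of a homomorphism of bialgebras between Hopf algebras is a Hopf subalgebra. -/
noncomputable def BialgHom.hopfRange {k A B : Type*} [Field k] [Ring A] [HopfAlgebra k A] [Ring B]
    [HopfAlgebra k B] (f : A →ₐc[k] B) : HopfSubalgebra k B where
  __ := (f : A →ₐ[k] B).range
  comul_mem' := by
    rintro _ ⟨a, rfl⟩
    refine ⟨TensorProduct.map (f : A →ₐ[k] B).rangeRestrict.toLinearMap
      (f : A →ₐ[k] B).rangeRestrict.toLinearMap (Coalgebra.comul (R := k) a), ?_⟩
    refine (LinearMap.congr_fun (TensorProduct.map_comp _ _ _ _).symm _).trans ?_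
    exact CoalgHomClass.map_comp_comul_apply f a
  antipode_mem' := by
    rintro _ ⟨a, rfl⟩
    exact ⟨HopfAlgebra.antipode k a, f.map_antipode a⟩

/-- An injective homomorphism of bialgebras between Hopf algebras is an isomorphism onto its
image. -/
noncomputable def BialgHom.equivHopfRange {k A B : Type*} [Field k] [Ring A] [HopfAlgebra k A]
    [Ring B] [HopfAlgebra k B] (f : A →ₐc[k] B) (hf : Function.Injective f) :
    A ≃ₐc[k] f.hopfRange.toSubalgebra :=
  BialgEquiv.ofAlgEquiv (AlgEquiv.ofInjective (f : A →ₐ[k] B) hf)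
    (AlgHom.ext fun a => CoalgHomClass.counit_comp_apply f a)
    (AlgHom.ext fun a => f.hopfRange.map_incl_injective (by
      refine (LinearMap.congr_fun (TensorProduct.map_comp _ _ _ _).symm _).trans ?_
      refine (CoalgHomClass.map_comp_comul_apply f a).trans ?_
      exact (f.hopfRange.map_incl_comulMap ((f : A →ₐ[k] B).rangeRestrict a)).symm))

/-! ### The enveloping algebra of the graph inside the smash product -/

namespace RotaBaxterGraph

open UniversalEnvelopingAlgebra

attribute [local instance 100] LieRing.ofAssociativeRing

variable {R : Type*} [CommRing R] {𝔤 𝔥 : Type*} [LieRing 𝔤] [LieAlgebra R 𝔤] [LieRing 𝔥]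
  [LieAlgebra R 𝔥] {φ : 𝔤 →ₗ⁅R⁆ LieDerivation R 𝔥 𝔥} {T : 𝔥 →ₗ[R] 𝔤}

lemma inr_mul_inl_ι (x : 𝔤) (a : UniversalEnvelopingAlgebra R 𝔥) :
    SmashProduct.inr (envelopingModuleBialgebra φ) (ι R x) * SmashProduct.inl _ a =
      SmashProduct.inl _ (derivExt (φ x) a) +
        SmashProduct.inl _ a * SmashProduct.inr _ (ι R x) := by
  have h : (envelopingModuleBialgebra φ).act (ι R x) a = derivExt (φ x) a :=
    congrArg (· a) (envelopingAct_ι φ x)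
  rw [SmashProduct.inr_mul_inl, comul_ι, map_add, map_add]
  simp only [TensorProduct.map_tmul, LinearMap.mul'_apply, LinearMap.comp_apply,
    LinearMap.flip_apply, AlgHom.toLinearMap_apply, map_one, mul_one, Module.End.one_apply, h]

variable (hT : IsRelativeRotaBaxterLie φ T)

/-- The algebra homomorphism `U(Gr_T) → U(𝔥) ⋊ U(𝔤)` that sends `(u, T u)` to `u # 1 + 1 # T u`. -/
noncomputable def toSmashAlgHom : UniversalEnvelopingAlgebra R (lieGraph φ T hT) →ₐ[R]
    SmashProduct (envelopingModuleBialgebra φ) :=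
  graphLift
    ((SmashProduct.inl (envelopingModuleBialgebra φ)).toLinearMap ∘ₗ
        (ι R : 𝔥 →ₗ⁅R⁆ UniversalEnvelopingAlgebra R 𝔥).toLinearMap +
      (SmashProduct.inr (envelopingModuleBialgebra φ)).toLinearMap ∘ₗ
        (ι R : 𝔤 →ₗ⁅R⁆ UniversalEnvelopingAlgebra R 𝔤).toLinearMap ∘ₗ T)
    (fun u v => by
      have h1 : T (⁅u, v⁆ + φ (T u) v - φ (T v) u) = ⁅T u, T v⁆ := by
        rw [hT]; congr 1; abel
      simp only [LinearMap.add_apply, LinearMap.comp_apply, h1]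
      simp only [AlgHom.toLinearMap_apply, LieHom.coe_toLinearMap, LieHom.map_lie, map_add, map_sub,
        LieRing.of_associative_ring_bracket, map_mul, add_mul, mul_add, inr_mul_inl_ι, derivExt_ι]
      abel)

variable {hT}

lemma toSmashAlgHom_gen (u : 𝔥) : toSmashAlgHom hT (gen hT u) =
    SmashProduct.inl _ (ι R u) + SmashProduct.inr _ (ι R (T u)) := graphLift_gen _ _ u

variable (hT)

/-- The homomorphism of bialgebras `U(Gr_T) → U(𝔥) ⋊ U(𝔤)` that extends the inclusion of `Gr_T`. -/
noncomputable def toSmash : UniversalEnvelopingAlgebra R (lieGraph φ T hT) →ₐc[R]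
    SmashProduct (envelopingModuleBialgebra φ) :=
  BialgHom.ofAlgHom (toSmashAlgHom hT)
    (algHom_ext fun y => by
      obtain ⟨u, rfl⟩ := graphMap_surjective hT y
      have h1 := SmashProduct.counit_inl_mul_inr (envelopingModuleBialgebra φ) (ι R u) 1
      have h2 := SmashProduct.counit_inl_mul_inr (envelopingModuleBialgebra φ) 1 (ι R (T u))
      rw [map_one, mul_one] at h1
      rw [map_one, one_mul] at h2
      change Coalgebra.counit (R := R) (toSmashAlgHom hT (gen hT u)) =
        Coalgebra.counit (R := R) (ι R (graphMap hT u))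
      rw [toSmashAlgHom_gen, map_add, h1, h2, counit_ι, counit_ι, counit_ι]
      simp)
    (algHom_ext fun y => by
      obtain ⟨u, rfl⟩ := graphMap_surjective hT y
      have h1 := SmashProduct.comul_inl_mul_inr (envelopingModuleBialgebra φ) (ι R u) 1
      have h2 := SmashProduct.comul_inl_mul_inr (envelopingModuleBialgebra φ) 1 (ι R (T u))
      rw [map_one, mul_one] at h1
      rw [map_one, one_mul] at h2
      change Algebra.TensorProduct.map _ _ (Coalgebra.comul (R := R) (ι R (graphMap hT u))) =
        Coalgebra.comul (R := R) (toSmashAlgHom hT (gen hT u))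
      rw [toSmashAlgHom_gen, map_add, h1, h2, comul_ι, comul_ι, comul_ι, Bialgebra.comul_one,
        Bialgebra.comul_one, map_one, map_one, mul_one, one_mul]
      simp only [map_add, Algebra.TensorProduct.map_tmul, map_one, ← gen_apply, toSmashAlgHom_gen,
        TensorProduct.add_tmul, TensorProduct.tmul_add]
      abel)

variable {hT}

lemma toSmash_gen (u : 𝔥) : toSmash hT (gen hT u) =
    SmashProduct.of _ (ι R u ⊗ₜ 1) + SmashProduct.of _ (1 ⊗ₜ ι R (T u)) := toSmashAlgHom_gen u

variable (hT)

/-- The coalgebra homomorphism `U(Gr_T) → U(𝔥) ⋊ U(𝔤) → U(𝔥)`. -/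
noncomputable def toBase :
    UniversalEnvelopingAlgebra R (lieGraph φ T hT) →ₗc[R] UniversalEnvelopingAlgebra R 𝔥 :=
  (SmashProduct.projLeft (envelopingModuleBialgebra φ)).comp (toSmash hT : _ →ₗc[R] _)

/-- The coalgebra homomorphism `U(Gr_T) → U(𝔥) ⋊ U(𝔤) → U(𝔤)`. -/
noncomputable def toActing :
    UniversalEnvelopingAlgebra R (lieGraph φ T hT) →ₗc[R] UniversalEnvelopingAlgebra R 𝔤 :=
  (SmashProduct.projRight (envelopingModuleBialgebra φ)).comp (toSmash hT : _ →ₗc[R] _)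

variable {hT}

lemma toBase_apply (c : UniversalEnvelopingAlgebra R (lieGraph φ T hT)) :
    toBase hT c = SmashProduct.projLeft _ (toSmash hT c) := rfl

lemma toActing_apply (c : UniversalEnvelopingAlgebra R (lieGraph φ T hT)) :
    toActing hT c = SmashProduct.projRight _ (toSmash hT c) := rfl

lemma toBase_one : toBase hT 1 = 1 := by
  rw [toBase_apply, map_one, SmashProduct.projLeft_one]

lemma toActing_one : toActing hT 1 = 1 := by
  rw [toActing_apply, map_one, SmashProduct.projRight_one]

lemma toActing_mul (c d : UniversalEnvelopingAlgebra R (lieGraph φ T hT)) :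
    toActing hT (c * d) = toActing hT c * toActing hT d := by
  rw [toActing_apply, map_mul, SmashProduct.projRight_mul]; rfl

lemma toBase_gen_mul (u : 𝔥) (c : UniversalEnvelopingAlgebra R (lieGraph φ T hT)) :
    toBase hT (gen hT u * c) = ι R u * toBase hT c + derivExt (φ (T u)) (toBase hT c) := by
  rw [toBase_apply, map_mul, toSmash_gen, add_mul, map_add, SmashProduct.projLeft_mul,
    SmashProduct.projLeft_mul, map_one, one_mul, Module.End.one_apply]
  exact congrArg _ (congrArg (· (toBase hT c)) (envelopingAct_ι φ (T u)))

lemma toActing_gen (u : 𝔥) : toActing hT (gen hT u) = ι R (T u) := by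
  rw [toActing_apply, toSmash_gen, map_add, SmashProduct.projRight_of, SmashProduct.projRight_of,
    counit_ι, Bialgebra.counit_one, zero_smul, one_smul, zero_add]

/-- The map `U(Gr_T) → U(𝔥)` is `𝔤`-linear. -/
lemma toBase_matchedAct (x : 𝔤) (c : UniversalEnvelopingAlgebra R (lieGraph φ T hT)) :
    toBase hT (matchedAct hT x c) = derivExt (φ x) (toBase hT c) := by
  induction c using induction_gen generalizing x with
  | one =>
    rw [matchedAct_one, map_zero, toBase_one, ← map_one (algebraMap R _), derivExt_algebraMap]
  | add c d hc hd => simp only [map_add, hc, hd]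
  | smul r c hc => simp only [map_smul, hc]
  | mul u c hc =>
    have h : ∀ (y z : 𝔤) (a : UniversalEnvelopingAlgebra R 𝔥), derivExt (φ ⁅y, z⁆) a =
        derivExt (φ y) (derivExt (φ z) a) - derivExt (φ z) (derivExt (φ y) a) := fun y z a =>
      congrArg (· a) (((derivExtHom R 𝔥).comp φ).map_lie y z)
    have h2 : derivExt (φ (reflect φ T u x)) (toBase hT c) =
        derivExt (φ ⁅x, T u⁆) (toBase hT c) - derivExt (φ (T (φ x u))) (toBase hT c) :=
      congrArg (· (toBase hT c)) (((derivExtHom R 𝔥).comp φ).map_sub ⁅x, T u⁆ (T (φ x u)))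
    rw [matchedAct_gen_mul, map_add, map_add, toBase_gen_mul, toBase_gen_mul, toBase_gen_mul, hc,
      hc, map_add, derivExt_mul, derivExt_ι, h2, h]
    abel

lemma toBase_surjective : Function.Surjective (toBase hT) := by
  intro a
  induction a using induction_mul_left with
  | one => exact ⟨1, toBase_one⟩
  | add a b ha hb =>
    obtain ⟨c, rfl⟩ := ha
    obtain ⟨d, rfl⟩ := hb
    exact ⟨c + d, map_add _ c d⟩
  | smul r a ha =>
    obtain ⟨c, rfl⟩ := ha
    exact ⟨r • c, map_smul _ r c⟩
  | mul u a ha =>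
    obtain ⟨c, rfl⟩ := ha
    exact ⟨baseAct hT u c, by
      rw [baseAct_apply, map_sub, toBase_gen_mul, toBase_matchedAct, add_sub_cancel_right]⟩

/-- The map `a ↦ a · 1` for the action of `U(𝔥)` on `U(Gr_T)` is a retraction of `toBase`. -/
lemma baseHom_toBase (c : UniversalEnvelopingAlgebra R (lieGraph φ T hT)) :
    baseHom hT (toBase hT c) 1 = c := by
  induction c using induction_gen with
  | one => rw [toBase_one]; exact congrArg (· 1) (map_one (baseHom hT))
  | add c d hc hd => simp only [map_add, LinearMap.add_apply, hc, hd]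
  | smul r c hc => simp only [map_smul, LinearMap.smul_apply, hc]
  | mul u c hc =>
    rw [toBase_gen_mul, map_add, LinearMap.add_apply, ← matchedAct_baseHom_one, map_mul,
      Module.End.mul_apply, hc, baseHom_ι, baseAct_apply, sub_add_cancel]

lemma toBase_bijective : Function.Bijective (toBase hT) :=
  ⟨fun c d h => by rw [← baseHom_toBase c, h, baseHom_toBase], toBase_surjective⟩

lemma toSmash_injective : Function.Injective (toSmash hT) := fun _ _ h =>
  toBase_bijective.1 (congrArg (SmashProduct.projLeft _) h)

/-! ### The lift and its graph -/

/-- A lift of `T` carries one projection of `U(Gr_T)` to the other. This determines it, since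
`toBase` is surjective. -/
lemma lift_toBase {Tbar : UniversalEnvelopingAlgebra R 𝔥 →ₗc[R] UniversalEnvelopingAlgebra R 𝔤}
    (h : IsRotaBaxterLift φ T Tbar) (c : UniversalEnvelopingAlgebra R (lieGraph φ T hT)) :
    Tbar (toBase hT c) = toActing hT c := by
  -- `Tbar 1` is group-like, hence invertible, and idempotent by the Rota-Baxter identity.
  have h1 : Tbar 1 = 1 := by
    have hg : IsGroupLikeElem R (Tbar 1) := (IsGroupLikeElem.one (R := R)).map Tbar
    have hm := h.rotaBaxter 1 1
    have h2 : rotaBaxterProduct (envelopingModuleBialgebra φ) Tbar.toLinearMap 1 1 = 1 := by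
      simp only [rotaBaxterProduct, Bialgebra.comul_one, Algebra.TensorProduct.one_def,
        TensorProduct.map_tmul, LinearMap.mul'_apply, LinearMap.id_apply, LinearMap.comp_apply,
        LinearMap.flip_apply, AlgHom.toLinearMap_apply, one_mul, ModuleBialgebra.act_one]
      exact (congrArg (· • _) hg.counit_eq_one).trans (one_smul _ _)
    rw [h2] at hm
    have h3 := congrArg (HopfAlgebra.antipode R (Tbar 1) * ·) hm
    simpa [← mul_assoc, hg.antipode_mul_cancel] using h3
  induction c using induction_gen with
  | one => rw [toBase_one, toActing_one, h1]
  | add c d hc hd => simp only [map_add, hc, hd]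
  | smul r c hc => simp only [map_smul, hc]
  | mul u c hc =>
    have h2 := h.rotaBaxter (ι R u) (toBase hT c)
    have h3 : rotaBaxterProduct (envelopingModuleBialgebra φ) Tbar.toLinearMap (ι R u)
        (toBase hT c) = toBase hT (gen hT u * c) := by
      have h4 : (envelopingModuleBialgebra φ).act (Tbar (ι R u)) (toBase hT c) =
          derivExt (φ (T u)) (toBase hT c) := by
        rw [h.restrict]
        exact congrArg (· (toBase hT c)) (envelopingAct_ι φ (T u))
      have h5 : Tbar.toLinearMap 1 = 1 := h1
      rw [toBase_gen_mul, ← h4, rotaBaxterProduct, comul_ι]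
      simp only [map_add, TensorProduct.map_tmul, LinearMap.mul'_apply, LinearMap.id_apply,
        LinearMap.comp_apply, LinearMap.flip_apply, AlgHom.toLinearMap_apply, one_mul,
        h5, map_one, Module.End.one_apply]
      rfl
    rw [← h3, ← h2, h.restrict, hc, toActing_mul, toActing_gen]

/-- If `Tbar` carries the projection of `U(Gr_T)` to `U(𝔥)` to the projection to `U(𝔤)`, then the
map from `U(Gr_T)` to the smash product is `c ↦ a₁ # Tbar(a₂)` with `a = toBase c`. -/
lemma toSmash_eq_graph {Tbar : UniversalEnvelopingAlgebra R 𝔥 →ₗc[R] UniversalEnvelopingAlgebra R 𝔤}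
    (h : ∀ c, Tbar (toBase hT c) = toActing hT c)
    (c : UniversalEnvelopingAlgebra R (lieGraph φ T hT)) :
    toSmash hT c = SmashProduct.of _ (TensorProduct.map LinearMap.id Tbar.toLinearMap
      (Coalgebra.comul (R := R) (toBase hT c))) := by
  have h1 : Tbar.toLinearMap ∘ₗ (toBase hT).toLinearMap =
      (SmashProduct.projRight _).toLinearMap ∘ₗ (toSmash hT).toCoalgHom.toLinearMap :=
    LinearMap.ext h
  have h2 : LinearMap.id ∘ₗ (toBase hT).toLinearMap =
      (SmashProduct.projLeft _).toLinearMap ∘ₗ (toSmash hT).toCoalgHom.toLinearMap := rfl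
  rw [← SmashProduct.map_proj_comul _ (toSmash hT c), ← CoalgHomClass.map_comp_comul_apply,
    ← CoalgHomClass.map_comp_comul_apply]
  refine congrArg (SmashProduct.of _) ?_
  refine (LinearMap.congr_fun (TensorProduct.map_comp _ _ _ _).symm _).trans ?_
  refine Eq.trans ?_ (LinearMap.congr_fun (TensorProduct.map_comp _ _ _ _) _)
  exact congrArg₂ (fun f g => TensorProduct.map f g (Coalgebra.comul (R := R) c)) h2.symm h1.symm

variable (hT)

/-- The lift of `T`: the inverse of `U(Gr_T) ≅ U(𝔥)`, followed by `U(Gr_T) → U(𝔤)`. -/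
noncomputable def rotaBaxterLift :
    UniversalEnvelopingAlgebra R 𝔥 →ₗc[R] UniversalEnvelopingAlgebra R 𝔤 :=
  (toActing hT).comp (CoalgEquiv.ofBijective (toBase_bijective (hT := hT))).symm.toCoalgHom

variable {hT}

lemma rotaBaxterLift_toBase (c : UniversalEnvelopingAlgebra R (lieGraph φ T hT)) :
    rotaBaxterLift hT (toBase hT c) = toActing hT c :=
  congrArg (toActing hT) ((CoalgEquiv.ofBijective (toBase_bijective (hT := hT))).symm_apply_apply c)

/-- The Rota-Baxter product is the projection to `U(𝔥)` of the product of elements of the graph. -/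
lemma rotaBaxterProduct_toBase
    {Tbar : UniversalEnvelopingAlgebra R 𝔥 →ₗc[R] UniversalEnvelopingAlgebra R 𝔤}
    (h : ∀ c, Tbar (toBase hT c) = toActing hT c)
    (c d : UniversalEnvelopingAlgebra R (lieGraph φ T hT)) :
    rotaBaxterProduct (envelopingModuleBialgebra φ) Tbar.toLinearMap (toBase hT c) (toBase hT d) =
      toBase hT (c * d) := by
  rw [toBase_apply (c * d), map_mul, toSmash_eq_graph h c, rotaBaxterProduct]
  induction Coalgebra.comul (R := R) (toBase hT c) with
  | zero => simp
  | add s t hs ht => simp only [map_add, add_mul, hs, ht]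
  | tmul a b =>
    rw [TensorProduct.map_tmul, TensorProduct.map_tmul, SmashProduct.projLeft_mul]
    rfl

lemma isRotaBaxterLift_rotaBaxterLift : IsRotaBaxterLift φ T (rotaBaxterLift hT) where
  rotaBaxter a b := by
    obtain ⟨c, rfl⟩ := toBase_surjective (hT := hT) a
    obtain ⟨d, rfl⟩ := toBase_surjective (hT := hT) b
    rw [rotaBaxterProduct_toBase rotaBaxterLift_toBase]
    simp only [rotaBaxterLift_toBase, toActing_mul]
  restrict u := by
    have h := toBase_gen_mul (hT := hT) u 1
    rw [mul_one, toBase_one, mul_one, ← map_one (algebraMap R _), derivExt_algebraMap,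
      add_zero] at h
    rw [← h, rotaBaxterLift_toBase, toActing_gen]

lemma range_toSmash {Tbar : UniversalEnvelopingAlgebra R 𝔥 →ₗc[R] UniversalEnvelopingAlgebra R 𝔤}
    (h : ∀ c, Tbar (toBase hT c) = toActing hT c) :
    Subalgebra.toSubmodule (toSmash hT : UniversalEnvelopingAlgebra R (lieGraph φ T hT) →ₐ[R]
      SmashProduct (envelopingModuleBialgebra φ)).range =
      (coalgGraph Tbar).map (SmashProduct.of (envelopingModuleBialgebra φ)).toLinearMap := by
  ext z
  constructor
  · rintro ⟨c, rfl⟩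
    exact ⟨_, ⟨toBase hT c, rfl⟩, (toSmash_eq_graph h c).symm⟩
  · rintro ⟨_, ⟨a, rfl⟩, rfl⟩
    obtain ⟨c, rfl⟩ := toBase_surjective (hT := hT) a
    exact ⟨c, toSmash_eq_graph h c⟩

end RotaBaxterGraph

theorem mainTheorem11 {k : Type*} [Field k] [IsAlgClosed k] [CharZero k]
    {𝔤 𝔥 : Type*} [LieRing 𝔤] [LieAlgebra k 𝔤] [LieRing 𝔥] [LieAlgebra k 𝔥]
    (φ : 𝔤 →ₗ⁅k⁆ LieDerivation k 𝔥 𝔥) (T : 𝔥 →ₗ[k] 𝔤) (hT : IsRelativeRotaBaxterLie φ T) :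
    (∃! Tbar : UniversalEnvelopingAlgebra k 𝔥 →ₗc[k] UniversalEnvelopingAlgebra k 𝔤,
      IsRotaBaxterLift φ T Tbar) ∧
    ∀ Tbar : UniversalEnvelopingAlgebra k 𝔥 →ₗc[k] UniversalEnvelopingAlgebra k 𝔤,
      IsRotaBaxterLift φ T Tbar →
      ∃ B : HopfSubalgebra k (SmashProduct (envelopingModuleBialgebra φ)),
        Subalgebra.toSubmodule B.toSubalgebra =
          (coalgGraph Tbar).map (SmashProduct.of (envelopingModuleBialgebra φ)).toLinearMap ∧
        ∃ e : UniversalEnvelopingAlgebra k (lieGraph φ T hT) ≃ₐc[k] B.toSubalgebra,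
          ∀ x, e (HopfAlgebra.antipode k x) = HopfAlgebra.antipode k (e x) := by
  refine ⟨⟨RotaBaxterGraph.rotaBaxterLift hT, RotaBaxterGraph.isRotaBaxterLift_rotaBaxterLift,
    fun Tbar h => CoalgHom.ext fun a => ?_⟩, fun Tbar h => ?_⟩
  · obtain ⟨c, rfl⟩ := RotaBaxterGraph.toBase_surjective (hT := hT) a
    rw [RotaBaxterGraph.lift_toBase h, RotaBaxterGraph.rotaBaxterLift_toBase]
  · exact ⟨(RotaBaxterGraph.toSmash hT).hopfRange,
      RotaBaxterGraph.range_toSmash (RotaBaxterGraph.lift_toBase h),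
      (RotaBaxterGraph.toSmash hT).equivHopfRange RotaBaxterGraph.toSmash_injective,
      fun x => BialgHom.map_antipode (BialgEquiv.toBialgHom
        ((RotaBaxterGraph.toSmash hT).equivHopfRange RotaBaxterGraph.toSmash_injective)) x⟩
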